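/- Let $\mathrm{Type}$ be an algebraic theory, i.e. a small category with finite products (for example a multi-sorted algebraic theory). A profunctor $M\colon C ⇸ D$ between small categories is a functor $M\colon C^{op}\times D\to\mathbf{Set}$; composition is $(M\odot N)(c,e)=\int^{d}M(c,d)\times N(d,e)$. A functor $F\colon C\to D$ has a companion $\hat F=D(F-,-)\colon C ⇸ D$ and a conjoint $\check F=D(-,F-)\colon D ⇸ C$. A profunctor $M\colon C ⇸ D$ is called algebraic if every $M(c,-)$ preserves finite products. A $\mathrm{Type}$-algebra is a finite-product-preserving functor $\mathrm{Type}\to\mathbf{Set}$; these span the full subcategory $\mathrm{Type}\text{-Alg}$ of $[\mathrm{Type},\mathbf{Set}]$. A schema $S$ consists of a small category $S_e$ and an algebraic profunctor $S_o\colon S_e ⇸ \mathrm{Type}$. Its collage $\mathrm{col}\,S$ is the category with objects $\mathrm{Ob}(S_e)\sqcup\mathrm{Ob}(\mathrm{Type})$, containing $S_e$ and $\mathrm{Type}$ as disjoint full subcategories, with $(\mathrm{col}\,S)(e,\tau)=S_o(e,\tau)$ and no morphisms $\tau\to e$; let $i_S\colon\mathrm{Type}\to\mathrm{col}\,S$ be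 the inclusion. The category $S\text{-Inst}$ is the full subcategory of $[\mathrm{col}\,S,\mathbf{Set}]$ on the functors whose restriction along $i_S$ is a $\mathrm{Type}$-algebra; restriction is a functor $U_S\colon S\text{-Inst}\to\mathrm{Type}\text{-Alg}$. Let $y_S\colon(\mathrm{col}\,S)^{op}\to S\text{-Inst}$, $s\mapsto(\mathrm{col}\,S)(s,-)$, be the Yoneda embedding. For functors $F\colon A\to C$ and $G\colon A\to D$, the category $(A/\mathbf{CAT})((C,F),(D,G))$ has as objects the functors $H\colon C\to D$ with $HF=G$, and as morphisms $H\to H'$ the natural transformations $\alpha$ with $\alpha F=\mathrm{id}_G$. Dually, for $F\colon C\to A$ and $G\colon D\to A$, the category $(\mathbf{CAT}/A)((C,F),(D,G))$ has as objects the functors $H\colon C\to D$ with $GH=F$, and as morphisms the natural transformations $\alpha$ with $G\alpha=\mathrm{id}_F$. **Theorem.** Let $R$ and $S$ be schemas. The following five categories are equivalent. 1. The category of $(R,S)$-bimodules: functors $M\colon(\mathrm{col}\,R)^{op}\to S\text{-Inst}$ with $M\circ i_R^{op}=y_S\circ i_S^{op}$, and natural transformations that are the identity on $\mathrm{Type}$.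 2. $(\mathrm{Type}^{op}/\mathbf{CAT})\big(((\mathrm{col}\,R)^{op},i_R^{op}),(S\text{-Inst},y_S i_S^{op})\big)$. 3. The category of profunctors $M\colon\mathrm{col}\,R ⇸ \mathrm{col}\,S$ such that $M\odot\check{i_S}$ is algebraic, equipped with an isomorphism $u_M\colon\hat{i_R}\odot M\cong\hat{i_S}$; morphisms are the transformations $\phi\colon M\Rightarrow N$ such that $\hat{i_R}\odot\phi$ becomes $\mathrm{id}_{\hat{i_S}}$ under $u_M$ and $u_N$. 4. $\mathrm{LAdj}_{\mathrm{Type}}(R\text{-Inst},S\text{-Inst})$, the full subcategory of $(\mathrm{Type}^{op}/\mathbf{CAT})\big((R\text{-Inst},y_R i_R^{op}),(S\text{-Inst},y_S i_S^{op})\big)$ spanned by the left adjoint functors. 5. $\mathrm{RAdj}_{\mathrm{Type}}(S\text{-Inst},R\text{-Inst})^{op}$, where $\mathrm{RAdj}_{\mathrm{Type}}(S\text{-Inst},R\text{-Inst})$ is the full subcategory of $(\mathbf{CAT}/\mathrm{Type}\text{-Alg})\big((S\text{-Inst},U_S),(R\text{-Inst},U_R)\big)$ spanned by the right adjoint functors.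 More precisely, equivalences can be chosen as follows. $1\simeq2$ keeps the underlying functors and transformations. $1\simeq3$ sends $M$, up to natural isomorphism of underlying profunctors, to $(r,s)\mapsto M(r)(s)$. $2\simeq4$ sends $M$ to $\Lambda_M$, a pointwise left Kan extension of $M$ along $y_R$, with inverse isomorphic to $L\mapsto L\circ y_R$ and with Kan extension unit $M\cong\Lambda_M\circ y_R$ given by the unit of the equivalence. $4\simeq5$ sends each $L$ to a right adjoint of $L$, and each $\alpha\colon L\to L'$ to its mate with respect to the chosen adjunctions. -/

import Mathlib

open CategoryTheory CategoryTheory.Limits Opposite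

universe u v₁ v₂ v₃ u₁ u₂ u₃

namespace AlgDB

noncomputable section

/-! ### Profunctors -/

/-- A profunctor `C ⇸ D` is a functor `Cᵒᵖ × D ⥤ Set`, here in curried form. (The profunctors of
Mathlib use the opposite convention: they are contravariant in the second category.) -/
abbrev Prof (C D : Type u) [SmallCategory C] [SmallCategory D] := Cᵒᵖ ⥤ D ⥤ Type u

namespace Prof

variable {C D E : Type u} [SmallCategory C] [SmallCategory D] [SmallCategory E]

/-- The companion `D(F -, -) : C ⇸ D` of a functor `F : C ⥤ D`. -/
def companion (F : C ⥤ D) : Prof C D := F.op ⋙ coyoneda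

/-- The conjoint `D(-, F -) : D ⇸ C` of a functor `F : C ⥤ D`. -/
def conjoint (F : C ⥤ D) : Prof D C := coyoneda ⋙ (Functor.whiskeringLeft C D (Type u)).obj F

/-- For `A : D ⥤ Set` and `B : Dᵒᵖ ⥤ Set`, the bifunctor `(d', d) ↦ A(d) × B(d')`. -/
def boxProd (A : D ⥤ Type u) (B : Dᵒᵖ ⥤ Type u) : Dᵒᵖ ⥤ D ⥤ Type u where
  obj d' :=
    { obj d := A.obj d × B.obj d'
      map f := ↾fun x ↦ (A.map f x.1, x.2)
      map_id d := by
        ext x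
        · exact ConcreteCategory.congr_hom (A.map_id d) (Prod.fst x)
        · rfl
      map_comp f g := by
        ext x
        · exact ConcreteCategory.congr_hom (A.map_comp f g) (Prod.fst x)
        · rfl }
  map g :=
    { app _ := ↾fun x ↦ (x.1, B.map g x.2)
      naturality _ _ _ := rfl }
  map_id d' := by
    ext d x
    · rfl
    · exact ConcreteCategory.congr_hom (B.map_id d') (Prod.snd x)
  map_comp f g := by
    ext d x
    · rfl
    · exact ConcreteCategory.congr_hom (B.map_comp f g) (Prod.snd x)

/-- Functoriality of `boxProd`. -/
def boxMap {A A' : D ⥤ Type u} {B B' : Dᵒᵖ ⥤ Type u} (α : A ⟶ A') (β : B ⟶ B') :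
    boxProd A B ⟶ boxProd A' B' where
  app d' :=
    { app d := ↾fun x ↦ (α.app d x.1, β.app d' x.2)
      naturality d₁ d₂ f := by
        dsimp only [boxProd]
        ext x
        · exact ConcreteCategory.congr_hom (α.naturality f) (Prod.fst x)
        · rfl }
  naturality d₁ d₂ g := by
    dsimp only [boxProd]
    ext d x
    · rfl
    · exact ConcreteCategory.congr_hom (β.naturality g) (Prod.snd x)

lemma boxMap_id (A : D ⥤ Type u) (B : Dᵒᵖ ⥤ Type u) : boxMap (𝟙 A) (𝟙 B) = 𝟙 _ := rfl

lemma boxMap_comp {A A' A'' : D ⥤ Type u} {B B' B'' : Dᵒᵖ ⥤ Type u} (α : A ⟶ A') (β : B ⟶ B')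
    (α' : A' ⟶ A'') (β' : B' ⟶ B'') : boxMap (α ≫ α') (β ≫ β') = boxMap α β ≫ boxMap α' β' := rfl

/-- The composite profunctor `M ⊙ N : C ⇸ E`, that is `(c, e) ↦ ∫^d M(c, d) × N(d, e)`. -/
def comp (M : Prof C D) (N : Prof D E) : Prof C E where
  obj c :=
    { obj e := coend (boxProd (M.obj c) (N.flip.obj e))
      map h := coend.map (boxMap (𝟙 _) (N.flip.map h))
      map_id e := by rw [CategoryTheory.Functor.map_id, boxMap_id, coend.map_id]
      map_comp h k := by rw [CategoryTheory.Functor.map_comp, coend.map_comp, ← boxMap_comp, Category.comp_id] }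
  map k :=
    { app e := coend.map (boxMap (M.map k) (𝟙 _))
      naturality _ _ h := by
        rw [coend.map_comp, coend.map_comp, ← boxMap_comp, ← boxMap_comp]
        simp only [Category.comp_id, Category.id_comp] }
  map_id c := by
    ext e : 2
    dsimp only
    rw [CategoryTheory.Functor.map_id, boxMap_id, coend.map_id]; rfl
  map_comp k l := by
    ext e : 2
    dsimp only [NatTrans.comp_app]
    rw [CategoryTheory.Functor.map_comp, coend.map_comp, ← boxMap_comp, Category.comp_id]

/-- The transformation `M ⊙ φ : M ⊙ N ⟶ M ⊙ N'` induced by `φ : N ⟶ N'`. -/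
def whiskerLeft (M : Prof C D) {N N' : Prof D E} (φ : N ⟶ N') : comp M N ⟶ comp M N' where
  app c :=
    { app e := coend.map (boxMap (𝟙 _) (((flipFunctor _ _ _).map φ).app e))
      naturality _ _ h := by
        dsimp only [comp]
        rw [coend.map_comp, coend.map_comp, ← boxMap_comp, ← boxMap_comp]
        congr 2
        exact ((flipFunctor _ _ _).map φ).naturality h }
  naturality _ _ k := by
    ext e : 2
    dsimp only [comp, NatTrans.comp_app]
    rw [coend.map_comp, coend.map_comp, ← boxMap_comp, ← boxMap_comp]
    simp only [Category.comp_id, Category.id_comp]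

lemma whiskerLeft_id (M : Prof C D) (N : Prof D E) : M.whiskerLeft (𝟙 N) = 𝟙 (M.comp N) := by
  refine NatTrans.ext (funext fun c ↦ NatTrans.ext (funext fun e ↦ ?_))
  exact coend.map_id (F := boxProd (M.obj c) (N.flip.obj e))

lemma whiskerLeft_comp (M : Prof C D) {N N' N'' : Prof D E} (φ : N ⟶ N') (ψ : N' ⟶ N'') :
    M.whiskerLeft (φ ≫ ψ) = M.whiskerLeft φ ≫ M.whiskerLeft ψ := by
  refine NatTrans.ext (funext fun c ↦ NatTrans.ext (funext fun e ↦ ?_))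
  exact (coend.map_comp (boxMap (𝟙 (M.obj c)) (((flipFunctor _ _ _).map φ).app e))
    (boxMap (𝟙 (M.obj c)) (((flipFunctor _ _ _).map ψ).app e))).symm

/-- A profunctor `C ⇸ D` is algebraic when it preserves finite products on the right. -/
def IsAlgebraic (M : Prof C D) : Prop := ∀ c, PreservesFiniteProducts (M.obj c)

end Prof

/-! ### Collages -/

section Collage

variable {C D : Type u} [SmallCategory C] [SmallCategory D]

/-- Objects of the collage of a profunctor `P : C ⇸ D`: the disjoint union of those of `C`, `D`. -/
inductive Collage (P : Prof C D) : Type u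
  | inl (c : C) : Collage P
  | inr (d : D) : Collage P

namespace Collage

variable {P : Prof C D}

/-- Morphisms of the collage: those of `C`, those of `D`, and the elements of `P(c, d)` as
morphisms from `c` to `d`; there are none from `d` to `c`. -/
def Hom : Collage P → Collage P → Type u
  | inl c, inl c' => c ⟶ c'
  | inl c, inr d => (P.obj (op c)).obj d
  | inr _, inl _ => PEmpty
  | inr d, inr d' => d ⟶ d'

/-- Identities of the collage. -/
def id : (x : Collage P) → Hom x x
  | inl c => 𝟙 c
  | inr d => 𝟙 d

/-- Composition in the collage: that of `C` and `D`, and the actions of `C` and `D` on `P`. -/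
def comp : {x y z : Collage P} → Hom x y → Hom y z → Hom x z
  | inl c, inl c', inl c'', f, g => (show c ⟶ c' from f) ≫ (show c' ⟶ c'' from g)
  | inl c, inl c', inr d, f, p =>
      (P.map (show c ⟶ c' from f).op).app d (show (P.obj (op c')).obj d from p)
  | inl c, inr d, inr d', p, g =>
      (P.obj (op c)).map (show d ⟶ d' from g) (show (P.obj (op c)).obj d from p)
  | inr d, inr d', inr d'', f, g => (show d ⟶ d' from f) ≫ (show d' ⟶ d'' from g)
  | inl _, inr _, inl _, _, g => g.elim
  | inr _, inl _, _, f, _ => f.elim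
  | inr _, inr _, inl _, _, g => g.elim

instance : SmallCategory (Collage P) where
  Hom := Hom
  id := id
  comp := comp
  id_comp := by
    rintro (c | d) (c' | d') f
    · exact Category.id_comp (obj := C) _
    · exact ConcreteCategory.congr_hom (congrArg (fun t ↦ NatTrans.app t d') (P.map_id (op c))) _
    · exact f.elim
    · exact Category.id_comp (obj := D) _
  comp_id := by
    rintro (c | d) (c' | d') f
    · exact Category.comp_id (obj := C) _
    · exact ConcreteCategory.congr_hom ((P.obj (op c)).map_id d') _
    · exact f.elim
    · exact Category.comp_id (obj := D) _
  assoc := by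
    rintro (w | w) (x | x) (y | y) (z | z) f g h <;>
      first
        | exact PEmpty.elim f
        | exact PEmpty.elim g
        | exact PEmpty.elim h
        | exact Category.assoc (obj := C) _ _ _
        | exact Category.assoc (obj := D) _ _ _
        | skip
    · exact ConcreteCategory.congr_hom (congrArg (fun t ↦ NatTrans.app t z)
        (P.map_comp (Quiver.Hom.op (X := x) (Y := y) g) (Quiver.Hom.op (X := w) (Y := x) f))) h
    · exact (ConcreteCategory.congr_hom
        ((P.map (Quiver.Hom.op (X := w) (Y := x) f)).naturality (X := y) (Y := z) h) g).symm
    · exact (ConcreteCategory.congr_hom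
        ((P.obj (op w)).map_comp (X := x) (Y := y) (Z := z) g h) f).symm

/-- The inclusion of `D` into the collage of `P : C ⇸ D`. -/
def inrFunctor (P : Prof C D) : D ⥤ Collage P where
  obj := inr
  map f := f

end Collage

end Collage

/-! ### Coslice and slice hom-categories -/

section Slice

variable {A : Type u₁} [Category.{v₁} A] {C : Type u₂} [Category.{v₂} C]
  {D : Type u₃} [Category.{v₃} D]

/-- A morphism `(C, F) → (D, G)` in the coslice 2-category `A / CAT`. -/
structure CosliceHom (F : A ⥤ C) (G : A ⥤ D) where
  /-- the underlying functor -/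
  functor : C ⥤ D
  comm : F ⋙ functor = G

namespace CosliceHom

variable {F : A ⥤ C} {G : A ⥤ D}

/-- A 2-cell of `A / CAT`: a natural transformation `α` such that `α F` is the identity of `G`. -/
@[ext]
structure Hom (H K : CosliceHom F G) where
  /-- the underlying natural transformation -/
  nat : H.functor ⟶ K.functor
  whisker_eq : F.whiskerLeft nat = eqToHom (H.comm.trans K.comm.symm)

instance : Category (CosliceHom F G) where
  Hom := Hom
  id H := ⟨𝟙 _, by simp⟩
  comp α β := ⟨α.nat ≫ β.nat, by
    rw [Functor.whiskerLeft_comp, α.whisker_eq, β.whisker_eq, eqToHom_trans]⟩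

/-- The functor from the coslice hom-category to the category of functors. -/
def forget (F : A ⥤ C) (G : A ⥤ D) : CosliceHom F G ⥤ C ⥤ D where
  obj H := H.functor
  map α := α.nat

end CosliceHom

/-- A morphism `(C, F) → (D, G)` in the slice 2-category `CAT / A`. -/
structure SliceHom (F : C ⥤ A) (G : D ⥤ A) where
  /-- the underlying functor -/
  functor : C ⥤ D
  comm : functor ⋙ G = F

namespace SliceHom

variable {F : C ⥤ A} {G : D ⥤ A}

/-- A 2-cell of `CAT / A`: a natural transformation `α` such that `G α` is the identity of `F`. -/
@[ext]
structure Hom (H K : SliceHom F G) where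
  /-- the underlying natural transformation -/
  nat : H.functor ⟶ K.functor
  whisker_eq : Functor.whiskerRight nat G = eqToHom (H.comm.trans K.comm.symm)

instance : Category (SliceHom F G) where
  Hom := Hom
  id H := ⟨𝟙 _, by simp⟩
  comp α β := ⟨α.nat ≫ β.nat, by
    rw [Functor.whiskerRight_comp, α.whisker_eq, β.whisker_eq, eqToHom_trans]⟩

end SliceHom

end Slice

/-! ### Schemas, instances and type algebras -/

/-- The category of algebras of an algebraic theory `T`: finite-product-preserving functors
`T ⥤ Set` and all natural transformations. -/
abbrev TypeAlg (T : Type u) [SmallCategory T] :=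
  ObjectProperty.FullSubcategory (fun A : T ⥤ Type u ↦ PreservesFiniteProducts A)

/-- A (database) schema over the algebraic theory `T`: a small entity category and an algebraic
profunctor of observables from it to `T`. -/
structure Schema (T : Type u) [SmallCategory T] where
  /-- the entity category -/
  Ent : Type u
  [cat : SmallCategory Ent]
  /-- the observables -/
  obs : Prof Ent T
  algebraic : obs.IsAlgebraic

attribute [instance] Schema.cat

namespace Schema

variable {T : Type u} [SmallCategory T] (S : Schema T)

/-- The collage of a schema. -/
abbrev Col := Collage S.obs

/-- The inclusion of the algebraic theory of types into the collage. -/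
abbrev iT : T ⥤ S.Col := Collage.inrFunctor S.obs

/-- A functor `S.Col ⥤ Set` is an instance if its restriction to types is a type algebra. -/
def isInst : ObjectProperty (S.Col ⥤ Type u) := fun I ↦ PreservesFiniteProducts (S.iT ⋙ I)

/-- The category of `S`-instances. -/
abbrev Inst := S.isInst.FullSubcategory

/-- The functor `S-Inst ⥤ Type-Alg` restricting an instance to types. -/
def U : S.Inst ⥤ TypeAlg T where
  obj I := ⟨S.iT ⋙ I.obj, I.property⟩
  map f := ObjectProperty.homMk (S.iT.whiskerLeft f.hom)

lemma isInst_coyoneda (x : S.Colᵒᵖ) : S.isInst (coyoneda.obj x) := by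
  obtain ⟨x⟩ := x
  cases x with
  | inl e => exact S.algebraic (op e)
  | inr t => exact (inferInstance : PreservesFiniteProducts (coyoneda.obj (op t)))

/-- The Yoneda embedding `s ↦ S.Col(s, -)`. -/
def y : S.Colᵒᵖ ⥤ S.Inst := S.isInst.lift coyoneda S.isInst_coyoneda

/-- The restriction of the Yoneda embedding to types. -/
abbrev yT : Tᵒᵖ ⥤ S.Inst := S.iT.op ⋙ S.y

end Schema

/-! ### The five categories -/

section Main

variable {T : Type u} [SmallCategory T] (R S : Schema T)

/-- An `(R, S)`-bimodule: a functor `M : R.Colᵒᵖ ⥤ S.Inst` with `M(τ) = y(τ)` for types `τ`. -/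
structure SchemaBimod where
  /-- the underlying functor -/
  functor : R.Colᵒᵖ ⥤ S.Inst
  comm : R.iT.op ⋙ functor = S.iT.op ⋙ S.y

namespace SchemaBimod

variable {R S}

lemma obj_eq (M : SchemaBimod R S) (τ : T) :
    M.functor.obj (op (R.iT.obj τ)) = S.y.obj (op (S.iT.obj τ)) :=
  Functor.congr_obj M.comm (op τ)

/-- A morphism of bimodules: a natural transformation that is the identity on types. -/
@[ext]
structure Hom (M N : SchemaBimod R S) where
  /-- the underlying natural transformation -/
  nat : M.functor ⟶ N.functor
  app_type : ∀ τ : T,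
    nat.app (op (R.iT.obj τ)) = eqToHom ((M.obj_eq τ).trans (N.obj_eq τ).symm)

instance : Category (SchemaBimod R S) where
  Hom := Hom
  id M := ⟨𝟙 _, by simp⟩
  comp α β := ⟨α.nat ≫ β.nat, fun τ ↦ by
    rw [NatTrans.comp_app, α.app_type, β.app_type, eqToHom_trans]⟩

variable (R S) in
/-- The functor sending a bimodule to its underlying functor. -/
def forget : SchemaBimod R S ⥤ R.Colᵒᵖ ⥤ S.Inst where
  obj M := M.functor
  map α := α.nat

end SchemaBimod

/-- The category `(Typeᵒᵖ / CAT)(R.Colᵒᵖ, S.Inst)`. -/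
abbrev TypeFunctors := CosliceHom R.iT.op S.yT

/-- A profunctor `M : R.Col ⇸ S.Col` whose composite with the conjoint of the inclusion of types
is algebraic, with an isomorphism between the composite of the companion of the inclusion of types
with `M` and the companion of the inclusion of types. -/
structure ProfBimod where
  /-- the underlying profunctor -/
  prof : Prof R.Col S.Col
  algebraic : (prof.comp (Prof.conjoint S.iT)).IsAlgebraic
  /-- the identification on types -/
  unitIso : (Prof.companion R.iT).comp prof ≅ Prof.companion S.iT

namespace ProfBimod

variable {R S}

/-- A profunctor transformation `φ` such that, with respect to the given identifications,
the whiskering of `φ` by the companion of the inclusion of types is the identity. -/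
@[ext]
structure Hom (M N : ProfBimod R S) where
  /-- the underlying transformation of profunctors -/
  nat : M.prof ⟶ N.prof
  whisker_eq : M.unitIso.inv ≫ (Prof.companion R.iT).whiskerLeft nat ≫ N.unitIso.hom =
    𝟙 (Prof.companion S.iT)

instance : Category (ProfBimod R S) where
  Hom := Hom
  id M := ⟨𝟙 _, by rw [Prof.whiskerLeft_id, Category.id_comp, Iso.inv_hom_id]⟩
  comp {M N K} α β := ⟨α.nat ≫ β.nat, by
    have h := congrArg₂ (fun s t ↦ s ≫ t) α.whisker_eq β.whisker_eq
    simpa only [Category.assoc, Iso.hom_inv_id_assoc, Category.id_comp, Prof.whiskerLeft_comp]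
      using h⟩

variable (R S) in
/-- The functor sending a `ProfBimod` to its underlying profunctor. -/
def forget : ProfBimod R S ⥤ Prof R.Col S.Col where
  obj M := M.prof
  map α := α.nat

end ProfBimod

/-- The full subcategory of `(Typeᵒᵖ / CAT)(R.Inst, S.Inst)` spanned by left adjoints. -/
abbrev LAdj := ObjectProperty.FullSubcategory
  (fun H : CosliceHom R.yT S.yT ↦ H.functor.IsLeftAdjoint)

/-- The full subcategory of `(CAT / Type-Alg)(S.Inst, R.Inst)` spanned by right adjoints. -/
abbrev RAdj := ObjectProperty.FullSubcategory
  (fun H : SliceHom S.U R.U ↦ H.functor.IsRightAdjoint)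

/-- Precomposition with the Yoneda embedding `R.y`. -/
def restrictY : LAdj R S ⥤ TypeFunctors R S where
  obj L := ⟨R.y ⋙ L.obj.functor, L.obj.comm⟩
  map α := ⟨R.y.whiskerLeft α.hom.nat, α.hom.whisker_eq⟩

end Main

end

end AlgDB

open AlgDB

/-! All five categories describe the same data: an `S`-instance `M(r)` for each object `r` of
`R.Col`, functorial in `r` and prescribed on types. The mathematical input is density of the Yoneda
embedding, cocompleteness of `S.Inst`, and the calculus of mates.

Between functors and left adjoints, the equivalence is restriction along `R.y`. Every instance is a
colimit of representables (`Schema.denseAtY`), so a left adjoint is the pointwise left Kan extension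
of its restriction; this makes `restrictY` fully faithful. For essential surjectivity, `M` has a
nerve `J ↦ S.Inst(M(-), J)`, which lands in instances because on types it is `J` itself by Yoneda.
Its left adjoint exists at representables, with value `M(r)`, hence everywhere because `S.Inst` is
cocomplete. Cocompleteness holds because instances are the objects local for a small set of maps
between finitely presentable functors, hence reflective.

Between left and right adjoints, an identification of `L` on represented types corresponds by
transposition and Yoneda to an identification of the type algebras underlying the right adjoint
(`TypeCompatible`). A transformation respects the former exactly when its mate respects the latter
(`TypeCompatible.conjugateEquiv_iff`), so passage to mates is fully faithful on the constrained
2-cells.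

Between bimodules and profunctors, co-Yoneda turns composition with a companion or conjoint into
restriction, so both conditions on the profunctor become statements about its values on types.

The constraints are equalities of functors, whereas these constructions yield isomorphisms.
`exists_strict_extension` and `exists_strict_lift` repair this by replacing a functor by an
isomorphic copy with prescribed objects. -/

namespace AlgDB

noncomputable section

/-! ### Strictification -/

section Strictify

variable {A : Type u₁} [Category.{v₁} A] {C : Type u₂} [Category.{v₂} C]
  {D : Type u₃} [Category.{v₃} D]

/-- A functor `L₀` that extends `G` along `F` up to isomorphism is isomorphic to one that extends
it strictly, provided that `F` identifies no more than `G` does. -/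
theorem exists_strict_extension (F : A ⥤ C) (G : A ⥤ D)
    (h : ∀ a b (e : F.obj a = F.obj b), ∃ (f : a ⟶ b) (e' : G.obj a = G.obj b),
      F.map f = eqToHom e ∧ G.map f = eqToHom e')
    (L₀ : C ⥤ D) (θ : F ⋙ L₀ ≅ G) :
    ∃ (L : C ⥤ D) (φ : L ≅ L₀) (hL : F ⋙ L = G),
      ∀ a, φ.hom.app (F.obj a) = eqToHom (Functor.congr_obj hL a) ≫ θ.inv.app a := by
  have key : ∀ c, ∃ (d : D) (i : d ≅ L₀.obj c), ∀ a (ha : F.obj a = c), ∃ e : d = G.obj a,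
      i.hom = eqToHom e ≫ θ.inv.app a ≫ L₀.map (eqToHom ha) := by
    intro c
    -- On the image of `F` the new value is that of `G` at some chosen preimage; the hypothesis `h`
    -- makes both the value and the isomorphism independent of this choice. Off the image nothing
    -- changes.
    by_cases hc : ∃ a, F.obj a = c
    · obtain ⟨a, rfl⟩ := hc
      refine ⟨G.obj a, (θ.app a).symm, fun b hb ↦ ?_⟩
      obtain ⟨f, e', hf, hf'⟩ := h b a hb
      refine ⟨e'.symm, ?_⟩
      have := θ.inv.naturality f
      dsimp at this ⊢
      rw [hf, hf'] at this
      rw [← this, eqToHom_trans_assoc, eqToHom_refl, Category.id_comp]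
    · exact ⟨L₀.obj c, Iso.refl _, fun a ha ↦ (hc ⟨a, ha⟩).elim⟩
  choose d i hi using key
  have hi' : ∀ a, ∃ e : d (F.obj a) = G.obj a, (i (F.obj a)).hom = eqToHom e ≫ θ.inv.app a := by
    intro a
    obtain ⟨e, he⟩ := hi _ a rfl
    exact ⟨e, by simpa using he⟩
  choose e he using hi'
  have he' : ∀ a, (i (F.obj a)).inv = θ.hom.app a ≫ eqToHom (e a).symm := by
    intro a
    rw [← cancel_epi (i (F.obj a)).hom, Iso.hom_inv_id, he]
    simp
  refine ⟨L₀.copyObj d (fun c ↦ (i c).symm), (L₀.isoCopyObj d (fun c ↦ (i c).symm)).symm,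
    CategoryTheory.Functor.ext e ?_, ?_⟩
  · intro a b f
    have := θ.hom.naturality f
    dsimp at this
    change (i _).hom ≫ L₀.map (F.map f) ≫ (i _).inv = _
    simp [he, he', reassoc_of% this]
    rfl
  · intro a
    simp [he]
    rfl

end Strictify

/-! ### Cocompleteness of categories of instances -/

section Cocomplete

theorem preservesFiniteProducts_iff_bijective {T : Type u₁} [Category.{v₁} T] [HasFiniteProducts T]
    (F : T ⥤ Type v₂) :
    PreservesFiniteProducts F ↔ ∀ (n : ℕ) (f : Fin n → T),
      Function.Bijective (fun (x : F.obj (∏ᶜ f)) (k : Fin n) ↦ F.map (Pi.π f k) x) := by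
  have key : ∀ (n : ℕ) (f : Fin n → T),
      Nonempty (IsLimit (F.mapCone (limit.cone (Discrete.functor f)))) ↔
        Function.Bijective (fun (x : F.obj (∏ᶜ f)) (k : Fin n) ↦ F.map (Pi.π f k) x) := by
    intro n f
    rw [Types.isLimit_iff, Function.bijective_iff_existsUnique]
    refine ⟨fun h b ↦ ?_, fun h s _ ↦ ?_⟩
    · obtain ⟨x, hx, hx'⟩ := h (fun j ↦ b j.as) (by
        rintro ⟨j⟩ ⟨k⟩ ⟨⟨h⟩⟩
        dsimp at h
        subst h
        exact ConcreteCategory.congr_hom (F.map_id _) _)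
      exact ⟨x, funext fun k ↦ hx ⟨k⟩, fun y hy ↦ hx' y fun j ↦ congrFun hy j.as⟩
    · obtain ⟨x, hx, hx'⟩ := h (fun k ↦ s ⟨k⟩)
      exact ⟨x, fun j ↦ congrFun hx j.as, fun y hy ↦ hx' y (funext fun k ↦ hy ⟨k⟩)⟩
  refine ⟨fun _ n f ↦ (key n f).1 ⟨isLimitOfPreserves F (limit.isLimit _)⟩, fun h ↦ ⟨fun n ↦ ?_⟩⟩
  refine ⟨fun {K} ↦ ?_⟩
  have : PreservesLimit (Discrete.functor (K.obj ∘ Discrete.mk)) F :=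
    preservesLimit_of_preserves_limit_cone (limit.isLimit _) ((key n _).2 (h n _)).some
  exact preservesLimit_of_iso_diagram F (Discrete.natIsoFunctor (F := K)).symm

/-- By Yoneda, mapping out of a representable is evaluation at an object, which preserves all
colimits. -/
theorem isCardinalPresentable_coyoneda {C : Type u} [SmallCategory C] (κ : Cardinal.{u})
    [Fact κ.IsRegular] (X : Cᵒᵖ) : IsCardinalPresentable (coyoneda.obj X) κ where
  preservesColimitOfShape J _ _ := by
    let e : coyoneda.obj (op (coyoneda.obj X)) ≅ (evaluation C (Type u)).obj X.unop :=
      NatIso.ofComponents (fun F ↦ coyonedaEquiv.toIso) (fun f ↦ by ext x; rfl)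
    exact preservesColimitsOfShape_of_natIso e.symm

variable {T : Type u} [SmallCategory T] [HasFiniteProducts T] (S : Schema T)

/-- The comparison from the coproduct of the instances represented by finitely many types to the
functor represented by their product. -/
def Schema.productComparison (f : Σ n : ℕ, Fin n → T) :
    ∐ (fun k ↦ coyoneda.obj (op (S.iT.obj (f.2 k)))) ⟶ coyoneda.obj (op (S.iT.obj (∏ᶜ f.2))) :=
  Sigma.desc fun k ↦ coyoneda.map (S.iT.map (Pi.π f.2 k)).op

/-- By Yoneda, maps to `J` out of the coproduct are families in `∏ J(τ_k)` and maps out of the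
represented product are elements of `J(∏ τ_k)`. Precomposition with the comparison is thus the
canonical map between these, and locality is preservation of finite products. -/
theorem Schema.isInst_eq_isLocal :
    S.isInst = (MorphismProperty.ofHoms S.productComparison).isLocal := by
  ext J
  have e : ∀ f : Σ n : ℕ, Fin n → T,
      Function.Bijective (fun g : coyoneda.obj (op (S.iT.obj (∏ᶜ f.2))) ⟶ J ↦
        S.productComparison f ≫ g) ↔
      Function.Bijective (fun (x : (S.iT ⋙ J).obj (∏ᶜ f.2)) k ↦ (S.iT ⋙ J).map (Pi.π f.2 k) x) := by
    intro f
    let Y k := coyoneda.obj (op (S.iT.obj (f.2 k)))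
    let e₁ : (∐ Y ⟶ J) ≃ ∀ k, J.obj (S.iT.obj (f.2 k)) :=
      { toFun g k := coyonedaEquiv (F := J) (Sigma.ι Y k ≫ g)
        invFun x := Sigma.desc fun k ↦ (coyonedaEquiv (F := J)).symm (x k)
        left_inv g := by
          apply Sigma.hom_ext
          intro k
          simp
        right_inv x := by
          funext k
          simp }
    rw [← e₁.comp_bijective,
      ← Function.Bijective.of_comp_iff _ (coyonedaEquiv (F := J)).symm.bijective]
    refine iff_of_eq (congrArg _ (funext fun x ↦ funext fun k ↦ ?_))
    have hk : Sigma.ι Y k ≫ S.productComparison f = coyoneda.map (S.iT.map (Pi.π f.2 k)).op :=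
      Sigma.ι_desc _ _
    have h₁ : ∀ g, e₁ g k = coyonedaEquiv (F := J) (Sigma.ι Y k ≫ g) := fun _ ↦ rfl
    dsimp only [Function.comp_apply]
    refine (h₁ _).trans ?_
    rw [reassoc_of% hk]
    exact congrArg (fun t ↦ J.map t x) (Category.comp_id _)
  rw [MorphismProperty.isLocal_iff]
  refine (preservesFiniteProducts_iff_bijective _).trans ⟨?_, fun h n f ↦ ?_⟩
  · rintro h _ _ _ ⟨f⟩
    exact (e f).2 (h f.1 f.2)
  · exact (e ⟨n, f⟩).1 (h _ (.mk (⟨n, f⟩ : Σ n : ℕ, Fin n → T)))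

/-- The orthogonal-reflection theorem applies: the comparison maps form a small set, and their
sources and targets are finitely presentable, being finite coproducts of representables and
representables. -/
instance Schema.isRightAdjoint_ι : S.isInst.ι.IsRightAdjoint := by
  rw [S.isInst_eq_isLocal]
  have : Fact Cardinal.aleph0.{u}.IsRegular := Cardinal.fact_isRegular_aleph0
  have : MorphismProperty.IsSmall.{u} (MorphismProperty.ofHoms S.productComparison) := inferInstance
  refine MorphismProperty.isRightAdjoint_ι_isLocal _ Cardinal.aleph0.{u} ?_
  rintro _ _ _ ⟨f⟩
  have h := fun X : S.Colᵒᵖ ↦ isCardinalPresentable_coyoneda Cardinal.aleph0.{u} X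
  refine ⟨?_, h _⟩
  have : ∀ k, IsCardinalPresentable ((Discrete.functor
    (fun k ↦ coyoneda.obj (op (S.iT.obj (f.2 k))))).obj k) Cardinal.aleph0.{u} := fun k ↦ h _
  exact isCardinalPresentable_of_isColimit _ (colimit.isColimit (Discrete.functor
    (fun k ↦ coyoneda.obj (op (S.iT.obj (f.2 k)))))) _ (by
      rw [hasCardinalLT_aleph0_iff]
      infer_instance)

instance Schema.hasColimits_inst : HasColimits S.Inst :=
  have : Reflective S.isInst.ι :=
    { L := S.isInst.ι.leftAdjoint, adj := Adjunction.ofIsRightAdjoint S.isInst.ι }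
  hasColimits_of_reflective S.isInst.ι

end Cocomplete

/-! ### Strict 2-cells in coslices and slices, and strict lifts -/

section Slice

variable {A : Type u₁} [Category.{v₁} A] {C : Type u₂} [Category.{v₂} C]
  {D : Type u₃} [Category.{v₃} D]

namespace CosliceHom

variable {F : A ⥤ C} {G : A ⥤ D}

lemma hom_ext {H K : CosliceHom F G} {α β : H ⟶ K} (h : Hom.nat α = Hom.nat β) : α = β :=
  Hom.ext h

lemma nat_app (H K : CosliceHom F G) (α : H ⟶ K) (a : A) :
    (Hom.nat α).app (F.obj a) = eqToHom (Functor.congr_obj (H.comm.trans K.comm.symm) a) := by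
  rw [← eqToHom_app (H.comm.trans K.comm.symm), ← Hom.whisker_eq α]
  rfl

/-- A natural transformation whose components at the objects of `A` are identities is a
morphism of the coslice hom-category. -/
def homMk {H K : CosliceHom F G} (α : H.functor ⟶ K.functor)
    (h : ∀ a, α.app (F.obj a) = eqToHom (Functor.congr_obj (H.comm.trans K.comm.symm) a)) :
    H ⟶ K where
  nat := α
  whisker_eq := by
    ext a
    rw [eqToHom_app]
    exact h a

/-- Constructor for isomorphisms of the coslice hom-category. -/
def isoMk {H K : CosliceHom F G} (α : H.functor ≅ K.functor)
    (h : ∀ a, α.hom.app (F.obj a) = eqToHom (Functor.congr_obj (H.comm.trans K.comm.symm) a)) :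
    H ≅ K where
  hom := homMk α.hom h
  inv := homMk α.inv fun a ↦ by
    rw [← cancel_epi (α.hom.app (F.obj a)), Iso.hom_inv_id_app, h, eqToHom_trans, eqToHom_refl]
  hom_inv_id := hom_ext α.hom_inv_id
  inv_hom_id := hom_ext α.inv_hom_id

end CosliceHom

namespace SliceHom

variable {F : C ⥤ A} {G : D ⥤ A}

lemma hom_ext {H K : SliceHom F G} {α β : H ⟶ K} (h : Hom.nat α = Hom.nat β) : α = β :=
  Hom.ext h

lemma map_nat_app (H K : SliceHom F G) (α : H ⟶ K) (c : C) :
    G.map ((Hom.nat α).app c) = eqToHom (Functor.congr_obj (H.comm.trans K.comm.symm) c) := by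
  rw [← eqToHom_app (H.comm.trans K.comm.symm), ← Hom.whisker_eq α]
  rfl

/-- A natural transformation whose components lie over identities of `A` is a morphism of the
slice hom-category. -/
def homMk {H K : SliceHom F G} (α : H.functor ⟶ K.functor)
    (h : ∀ c, G.map (α.app c) = eqToHom (Functor.congr_obj (H.comm.trans K.comm.symm) c)) :
    H ⟶ K where
  nat := α
  whisker_eq := by
    ext c
    rw [eqToHom_app]
    exact h c

end SliceHom

/-- A functor `L₀` that lifts `F` along `G` up to isomorphism is isomorphic to a strict lift,
provided that the components of the isomorphism lift to isomorphisms along `G`. -/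
theorem exists_strict_lift (F : C ⥤ A) (G : D ⥤ A) (L₀ : C ⥤ D) (θ : L₀ ⋙ G ≅ F)
    (h : ∀ c, ∃ (d : D) (i : d ≅ L₀.obj c) (e : G.obj d = F.obj c),
      G.map i.hom = eqToHom e ≫ θ.inv.app c) :
    ∃ (L : C ⥤ D) (φ : L ≅ L₀) (hL : L ⋙ G = F),
      ∀ c, G.map (φ.hom.app c) = eqToHom (Functor.congr_obj hL c) ≫ θ.inv.app c := by
  choose d i e he using h
  have he' : ∀ c, G.map (i c).inv = θ.hom.app c ≫ eqToHom (e c).symm := by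
    intro c
    rw [← cancel_epi (G.map (i c).hom), ← G.map_comp, Iso.hom_inv_id, he]
    simp
  refine ⟨L₀.copyObj d (fun c ↦ (i c).symm), (L₀.isoCopyObj d (fun c ↦ (i c).symm)).symm,
    CategoryTheory.Functor.ext e ?_, ?_⟩
  · intro a b f
    have := θ.hom.naturality f
    dsimp at this
    change G.map ((i _).hom ≫ L₀.map f ≫ (i _).inv) = _
    simp [he, he', reassoc_of% this]
    rfl
  · intro c
    exact he c

end Slice

/-! ### Strictifying functors between categories of instances -/

section EmptyExtension

variable {T : Type u} [SmallCategory T] (S : Schema T)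

lemma iT_obj_injective {a b : T} (h : S.iT.obj a = S.iT.obj b) : a = b := by
  injection h

instance : S.iT.Full where
  map_surjective f := ⟨f, rfl⟩

instance : S.iT.Faithful where
  map_injective h := h

instance : S.y.Full := inferInstanceAs (S.isInst.lift _ _).Full

instance : S.y.Faithful := inferInstanceAs (S.isInst.lift _ _).Faithful

/-- The extension of a functor on types to the collage by the empty set on entities. -/
def Schema.emptyExtension : (T ⥤ Type u) ⥤ (S.Col ⥤ Type u) where
  obj A :=
    { obj x := match x with
        | .inl _ => PEmpty
        | .inr τ => A.obj τ
      map {x y} f := match x, y, f with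
        | .inl _, _, _ => ↾PEmpty.elim
        | .inr _, .inl _, f => PEmpty.elim f
        | .inr _, .inr _, f => A.map f
      map_id x := by
        cases x with
        | inl e => ext x; exact x.elim
        | inr t => exact A.map_id t
      map_comp {x y z} f g := by
        cases x with
        | inl e => ext x; exact x.elim
        | inr t =>
          cases y with
          | inl e => exact PEmpty.elim f
          | inr t =>
            cases z with
            | inl e => exact PEmpty.elim g
            | inr t => exact A.map_comp f g }
  map α :=
    { app x := match x with
        | .inl _ => 𝟙 _
        | .inr τ => α.app τ
      naturality x y f := by
        cases x with
        | inl e => ext x; exact x.elim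
        | inr t =>
          cases y with
          | inl e => exact PEmpty.elim f
          | inr t => exact α.naturality f }
  map_id A := by
    ext x : 2
    cases x <;> rfl
  map_comp α β := by
    ext x : 2
    cases x <;> rfl

/-- `emptyExtension` as a functor to instances. -/
def Schema.initialExtension : TypeAlg T ⥤ S.Inst where
  obj A := ⟨S.emptyExtension.obj A.obj, A.property⟩
  map α := ObjectProperty.homMk (S.emptyExtension.map α.hom)

/-- There are no morphisms from types to entities in the collage, so a represented type really is
empty on entities. This is an equality, not just an isomorphism. -/
lemma Schema.emptyExtension_coyoneda (τ : T) :
    S.emptyExtension.obj (coyoneda.obj (op τ)) = coyoneda.obj (op (S.iT.obj τ)) := by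
  refine CategoryTheory.Functor.ext (fun x ↦ by cases x <;> rfl) fun x y f ↦ ?_
  cases x with
  | inl e => ext x; exact x.elim
  | inr t =>
    cases y with
    | inl e => exact PEmpty.elim f
    | inr t => rfl

/-- Represented types depend on the schema only through the empty extension. Hence `S.yT` factors
strictly through `R.yT`, and any coincidence of objects under `R.yT` also occurs under `S.yT`. -/
lemma Schema.yT_U_initialExtension (R : Schema T) : R.yT ⋙ R.U ⋙ S.initialExtension = S.yT := by
  have e : ∀ τ, (R.yT ⋙ R.U ⋙ S.initialExtension).obj τ = S.yT.obj τ := fun τ ↦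
    ObjectProperty.FullSubcategory.ext (S.emptyExtension_coyoneda τ.unop)
  refine CategoryTheory.Functor.ext e fun τ τ' f ↦ ?_
  have he : ∀ {X Y : S.Inst} (h : X = Y), (eqToHom h).hom = eqToHom (congrArg (·.obj) h) := by
    rintro X _ rfl
    rfl
  apply ObjectProperty.hom_ext
  rw [ObjectProperty.FullSubcategory.comp_hom, ObjectProperty.FullSubcategory.comp_hom, he, he]
  ext x : 2
  rw [NatTrans.comp_app, NatTrans.comp_app, eqToHom_app, eqToHom_app]
  cases x with
  | inl e => ext x; exact x.elim
  | inr t => rfl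

/-- A functor between categories of instances that preserves represented types up to isomorphism
is isomorphic to one that preserves them strictly. -/
theorem Schema.exists_strict_yT (R : Schema T) (L₀ : R.Inst ⥤ S.Inst) (θ : R.yT ⋙ L₀ ≅ S.yT) :
    ∃ (L : R.Inst ⥤ S.Inst) (φ : L ≅ L₀) (hL : R.yT ⋙ L = S.yT),
      ∀ a, φ.hom.app (R.yT.obj a) = eqToHom (Functor.congr_obj hL a) ≫ θ.inv.app a := by
  -- Distinct types may represent equal instances, so injectivity of `R.yT` on objects is
  -- unavailable. Instead the equality `e` is pulled back to a morphism by full faithfulness and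
  -- transported through the factorization `hK`.
  refine exists_strict_extension _ _ (fun a b e ↦ ?_) L₀ θ
  have hK := S.yT_U_initialExtension R
  have : S.yT.obj a = S.yT.obj b := by
    rw [← hK, Functor.comp_obj, e]
    rfl
  refine ⟨R.yT.preimage (eqToHom e), this, R.yT.map_preimage _, ?_⟩
  rw [Functor.congr_hom hK.symm, Functor.comp_map, R.yT.map_preimage, eqToHom_map]
  simp

/-- A functor between categories of instances that preserves the underlying type algebras up to
isomorphism is isomorphic to one that preserves them strictly. -/
theorem Schema.exists_strict_U (R : Schema T) (G₀ : S.Inst ⥤ R.Inst) (θ : G₀ ⋙ R.U ≅ S.U) :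
    ∃ (G : S.Inst ⥤ R.Inst) (φ : G ≅ G₀) (hG : G ⋙ R.U = S.U),
      ∀ J, R.U.map (φ.hom.app J) = eqToHom (Functor.congr_obj hG J) ≫ θ.inv.app J := by
  refine exists_strict_lift _ _ G₀ θ fun J ↦ ?_
  -- The instance is altered only at types, where its sets are replaced by those of `S.U.obj J`;
  -- this works because `R.iT` is injective on objects.
  obtain ⟨I, φ, hI, h⟩ := exists_strict_extension R.iT (S.U.obj J).obj
    (fun a b e ↦ by
      obtain rfl := iT_obj_injective R e
      exact ⟨𝟙 a, rfl, by simp, by simp⟩) (G₀.obj J).obj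
    (((ObjectProperty.ι _).mapIso (θ.app J)))
  have hI' : R.isInst I := by
    rw [Schema.isInst, hI]
    exact (S.U.obj J).property
  have e : R.U.obj ⟨I, hI'⟩ = S.U.obj J := ObjectProperty.FullSubcategory.ext hI
  have he : ∀ {X Y : TypeAlg T} (h : X = Y), (eqToHom h).hom = eqToHom (congrArg (·.obj) h) := by
    rintro X _ rfl
    rfl
  refine ⟨⟨I, hI'⟩, R.isInst.isoMk φ, e, ?_⟩
  apply ObjectProperty.hom_ext
  ext τ : 2
  rw [ObjectProperty.FullSubcategory.comp_hom, he, NatTrans.comp_app, eqToHom_app]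
  exact h τ

end EmptyExtension

/-! ### Recognizing a left adjoint along a functor -/

section Transpose

variable {A : Type u₁} [Category.{v₁} A] {C : Type u₂} [Category.{v₂} C]
  {D : Type u₃} [Category.{v₃} D]

/-- If `C(Y a, G d) ≅ D(M a, d)` naturally, for `L` left adjoint to `G`, then `L Y ≅ M`. -/
theorem exists_iso_of_homEquiv {L : C ⥤ D} {G : D ⥤ C} (adj : L ⊣ G) (Y : A ⥤ C) (M : A ⥤ D)
    (e : ∀ a d, (M.obj a ⟶ d) ≃ (Y.obj a ⟶ G.obj d))
    (he : ∀ {a d d'} (x : M.obj a ⟶ d) (g : d ⟶ d'), e a d' (x ≫ g) = e a d x ≫ G.map g)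
    (he' : ∀ {a b d} (f : a ⟶ b) (x : M.obj b ⟶ d), e a d (M.map f ≫ x) = Y.map f ≫ e b d x) :
    ∃ κ : Y ⋙ L ≅ M, ∀ {a d} (g : M.obj a ⟶ d),
      adj.homEquiv _ _ (κ.hom.app a ≫ g) = e a d g := by
  -- The candidate isomorphism is the transpose of the universal element `e (𝟙)`; this identity
  -- determines it and yields both inverse laws and naturality.
  have spec : ∀ {a d} (g : M.obj a ⟶ d),
      adj.homEquiv _ _ ((adj.homEquiv _ _).symm (e a _ (𝟙 _)) ≫ g) = e a d g := by
    intro a d g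
    rw [adj.homEquiv_naturality_right, Equiv.apply_symm_apply, ← he, Category.id_comp]
  refine ⟨NatIso.ofComponents
    (fun a ↦
      { hom := (adj.homEquiv _ _).symm (e a _ (𝟙 _))
        inv := (e a _).symm (adj.unit.app _)
        hom_inv_id := (adj.homEquiv _ _).injective (by
          rw [spec, Equiv.apply_symm_apply]
          exact (adj.homEquiv_id _).symm)
        inv_hom_id := (e a _).injective (by
          rw [he, Equiv.apply_symm_apply, ← adj.homEquiv_unit, Equiv.apply_symm_apply]) })
    (fun {a b} f ↦ (adj.homEquiv _ _).injective ?_), spec⟩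
  refine Eq.trans ?_ (spec (M.map f)).symm
  change adj.homEquiv _ _ (L.map (Y.map f) ≫ (adj.homEquiv _ _).symm (e b _ (𝟙 _))) = _
  rw [adj.homEquiv_naturality_left, Equiv.apply_symm_apply, ← he', Category.comp_id]

end Transpose

/-! ### Adjunctions compatible with types -/

section TypeAdjunction

variable {T : Type u} [SmallCategory T] {R S : Schema T}

variable (S) in
/-- The Yoneda lemma for instances. -/
def Schema.yEquiv (x : S.Colᵒᵖ) (J : S.Inst) : (S.y.obj x ⟶ J) ≃ J.obj.obj x.unop :=
  S.isInst.fullyFaithfulι.homEquiv.trans (coyonedaEquiv (F := J.obj))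

lemma Schema.yEquiv_comp {x : S.Colᵒᵖ} {J J' : S.Inst} (g : S.y.obj x ⟶ J) (h : J ⟶ J') :
    S.yEquiv x J' (g ≫ h) = h.hom.app _ (S.yEquiv x J g) := rfl

lemma Schema.yEquiv_map_comp {x y : S.Colᵒᵖ} {J : S.Inst} (f : x ⟶ y) (g : S.y.obj y ⟶ J) :
    S.yEquiv x J (S.y.map f ≫ g) = J.obj.map f.unop (S.yEquiv y J g) :=
  (coyonedaEquiv_naturality (F := J.obj) g.hom f.unop).symm

variable (S) in
/-- The Yoneda lemma for instances, at types. -/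
def Schema.typeEquiv (τ : Tᵒᵖ) (J : S.Inst) : (S.yT.obj τ ⟶ J) ≃ (S.U.obj J).obj.obj τ.unop :=
  S.yEquiv (S.iT.op.obj τ) J

lemma Schema.typeEquiv_comp {τ : Tᵒᵖ} {J J' : S.Inst} (g : S.yT.obj τ ⟶ J) (h : J ⟶ J') :
    S.typeEquiv τ J' (g ≫ h) = (S.U.map h).hom.app _ (S.typeEquiv τ J g) := rfl

lemma Schema.typeEquiv_map_comp {τ τ' : Tᵒᵖ} {J : S.Inst} (f : τ ⟶ τ') (g : S.yT.obj τ' ⟶ J) :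
    S.typeEquiv τ J (S.yT.map f ≫ g) = (S.U.obj J).obj.map f.unop (S.typeEquiv τ' J g) :=
  S.yEquiv_map_comp (S.iT.op.map f) g

variable {L L' : R.Inst ⥤ S.Inst} {G G' : S.Inst ⥤ R.Inst}

/-- Compatibility of an adjunction `L ⊣ G` between categories of instances with an identification
`l` of the values of `L` at represented types and an identification `r` of the underlying type
algebras of the values of `G`. -/
def TypeCompatible (adj : L ⊣ G) (l : R.yT ⋙ L ≅ S.yT) (r : G ⋙ R.U ≅ S.U) : Prop :=
  ∀ (τ : Tᵒᵖ) (J : S.Inst) (g : S.yT.obj τ ⟶ J),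
    (r.hom.app J).hom.app τ.unop (R.typeEquiv τ _ (adj.homEquiv _ _ (l.hom.app τ ≫ g))) =
      S.typeEquiv τ J g

/-- Elements of `G J` at `τ` are maps from the represented type to `G J`, hence by adjunction maps
`L (R.yT τ) ⟶ J`, hence through `l` maps `S.yT τ ⟶ J`, that is, elements of `J` at `τ`. -/
theorem exists_typeCompatible_right (adj : L ⊣ G) (l : R.yT ⋙ L ≅ S.yT) :
    ∃ r : G ⋙ R.U ≅ S.U, TypeCompatible adj l r := by
  let e (τ : Tᵒᵖ) (J : S.Inst) :
      (R.U.obj (G.obj J)).obj.obj τ.unop ≃ (S.U.obj J).obj.obj τ.unop :=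
    (R.typeEquiv τ (G.obj J)).symm.trans ((adj.homEquiv _ _).symm.trans
      ((l.app τ).homFromEquiv.trans (S.typeEquiv τ J)))
  have he (τ J) (g : S.yT.obj τ ⟶ J) :
      e τ J (R.typeEquiv τ _ (adj.homEquiv _ _ (l.hom.app τ ≫ g))) = S.typeEquiv τ J g := by
    simp [e]
  -- Every element is a transpose of some `g`, so both naturality checks can be made on transposes,
  -- where `he` computes the bijection.
  have hs (τ J) (x : (R.U.obj (G.obj J)).obj.obj τ.unop) :
      ∃ g : S.yT.obj τ ⟶ J, R.typeEquiv τ _ (adj.homEquiv _ _ (l.hom.app τ ≫ g)) = x :=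
    ⟨(S.typeEquiv τ J).symm (e τ J x), by simp [e]⟩
  refine ⟨NatIso.ofComponents (fun J ↦ ObjectProperty.isoMk _
    (NatIso.ofComponents (fun τ ↦ (e (op τ) J).toIso) fun {τ τ'} f ↦ ?_)) fun {J J'} f ↦ ?_,
      fun τ J g ↦ he τ J g⟩
  · ext x
    obtain ⟨g, rfl⟩ := hs (op τ) J x
    change e (op τ') J ((R.U.obj (G.obj J)).obj.map f _) =
      (S.U.obj J).obj.map f (e (op τ) J _)
    rw [he]
    refine Eq.trans (congrArg (e (op τ') J) ?_)
      ((he (op τ') J (S.yT.map f.op ≫ g)).trans (S.typeEquiv_map_comp f.op g))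
    refine (R.typeEquiv_map_comp f.op _).symm.trans ?_
    rw [← adj.homEquiv_naturality_left, ← l.hom.naturality_assoc]
    rfl
  · apply ObjectProperty.hom_ext
    ext τ x
    obtain ⟨g, rfl⟩ := hs (op τ) J x
    change e (op τ) J' ((R.U.map (G.map f)).hom.app τ _) =
      (S.U.map f).hom.app τ (e (op τ) J _)
    rw [he, ← R.typeEquiv_comp, ← S.typeEquiv_comp, ← he, ← adj.homEquiv_naturality_right,
      Category.assoc]

/-- The same chain of bijections read backwards shows that `S.yT τ` corepresents `J ↦ (R.yT τ ⟶ G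
J)`, as does `L (R.yT τ)`. -/
theorem exists_typeCompatible_left (adj : L ⊣ G) (r : G ⋙ R.U ≅ S.U) :
    ∃ l : R.yT ⋙ L ≅ S.yT, TypeCompatible adj l r := by
  let i (τ : Tᵒᵖ) (J : S.Inst) :
      (R.U.obj (G.obj J)).obj.obj τ.unop ≃ (S.U.obj J).obj.obj τ.unop :=
    (((ObjectProperty.ι _).mapIso (r.app J)).app τ.unop).toEquiv
  have hi (τ J x) : i τ J x = (r.hom.app J).hom.app τ.unop x := rfl
  obtain ⟨κ, hκ⟩ := exists_iso_of_homEquiv adj R.yT S.yT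
    (fun τ J ↦ (S.typeEquiv τ J).trans ((i τ J).symm.trans (R.typeEquiv τ _).symm)) (by
      intro τ J J' x g
      apply (R.typeEquiv τ _).injective
      apply (i τ J').injective
      rw [R.typeEquiv_comp]
      simp only [Equiv.trans_apply, Equiv.apply_symm_apply]
      rw [S.typeEquiv_comp]
      have := ConcreteCategory.congr_hom (congrArg (fun t ↦ t.hom.app τ.unop) (r.hom.naturality g))
        ((i τ J).symm (S.typeEquiv τ J x))
      refine Eq.trans ?_ this.symm
      change _ = (S.U.map g).hom.app τ.unop (i τ J _)
      rw [Equiv.apply_symm_apply]) (by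
      intro τ τ' J f x
      apply (R.typeEquiv τ _).injective
      apply (i τ J).injective
      rw [R.typeEquiv_map_comp]
      simp only [Equiv.trans_apply, Equiv.apply_symm_apply]
      rw [S.typeEquiv_map_comp]
      have := ConcreteCategory.congr_hom ((r.hom.app J).hom.naturality f.unop)
        ((i τ' J).symm (S.typeEquiv τ' J x))
      refine Eq.trans ?_ this.symm
      change _ = (S.U.obj J).obj.map f.unop (i τ' J _)
      rw [Equiv.apply_symm_apply])
  refine ⟨κ, fun τ J g ↦ ?_⟩
  rw [hκ, ← hi]
  simp

theorem TypeCompatible.ofNatIsoLeft {adj : L ⊣ G} {l : R.yT ⋙ L ≅ S.yT} {r : G ⋙ R.U ≅ S.U}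
    (h : TypeCompatible adj l r) (φ : L' ≅ L) (l' : R.yT ⋙ L' ≅ S.yT)
    (hl : ∀ τ, l'.hom.app τ = φ.hom.app _ ≫ l.hom.app τ) :
    TypeCompatible (adj.ofNatIsoLeft φ.symm) l' r := by
  intro τ J g
  rw [← h τ J g, hl]
  simp [Adjunction.homEquiv_unit, Adjunction.ofNatIsoLeft]

theorem TypeCompatible.ofNatIsoRight {adj : L ⊣ G} {l : R.yT ⋙ L ≅ S.yT} {r : G ⋙ R.U ≅ S.U}
    (h : TypeCompatible adj l r) (φ : G' ≅ G) (r' : G' ⋙ R.U ≅ S.U)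
    (hr : ∀ J, r'.hom.app J = R.U.map (φ.hom.app J) ≫ r.hom.app J) :
    TypeCompatible (adj.ofNatIsoRight φ.symm) l r' := by
  intro τ J g
  rw [← h τ J g, hr, ObjectProperty.FullSubcategory.comp_hom, NatTrans.comp_app]
  change (r.hom.app J).hom.app τ.unop ((R.U.map (φ.hom.app J)).hom.app τ.unop _) = _
  rw [← R.typeEquiv_comp]
  simp [Adjunction.homEquiv_unit, Adjunction.ofNatIsoRight]

/-- Transposition turns precomposition with `α` into postcomposition with its mate (`hα`). Both
conditions therefore say that the two compatible ways of reading an element of type `τ` agree. -/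
theorem TypeCompatible.conjugateEquiv_iff {adj : L ⊣ G} {l : R.yT ⋙ L ≅ S.yT}
    {r : G ⋙ R.U ≅ S.U} (h : TypeCompatible adj l r) {adj' : L' ⊣ G'} {l' : R.yT ⋙ L' ≅ S.yT}
    {r' : G' ⋙ R.U ≅ S.U} (h' : TypeCompatible adj' l' r') (α : L ⟶ L') :
    (∀ τ, α.app (R.yT.obj τ) ≫ l'.hom.app τ = l.hom.app τ) ↔
      ∀ J, R.U.map ((conjugateEquiv adj' adj α).app J) ≫ r.hom.app J = r'.hom.app J := by
  have hα (X : R.Inst) (J : S.Inst) (f : L'.obj X ⟶ J) :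
      adj.homEquiv _ _ (α.app X ≫ f) = adj'.homEquiv _ _ f ≫ (conjugateEquiv adj' adj α).app J := by
    rw [adj'.homEquiv_unit, Category.assoc, (conjugateEquiv adj' adj α).naturality,
      ← Category.assoc, unit_conjugateEquiv, adj.homEquiv_unit, G.map_comp, Category.assoc]
  have hr (τ J) (g : S.yT.obj τ ⟶ J) :
      (R.U.map ((conjugateEquiv adj' adj α).app J) ≫ r.hom.app J).hom.app τ.unop
        (R.typeEquiv τ _ (adj'.homEquiv _ _ (l'.hom.app τ ≫ g))) =
      (r.hom.app J).hom.app τ.unop (R.typeEquiv τ _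
        (adj.homEquiv _ _ ((α.app (R.yT.obj τ) ≫ l'.hom.app τ) ≫ g))) := by
    rw [ObjectProperty.FullSubcategory.comp_hom, NatTrans.comp_app]
    change (r.hom.app J).hom.app τ.unop
      ((R.U.map ((conjugateEquiv adj' adj α).app J)).hom.app τ.unop _) = _
    rw [← R.typeEquiv_comp, ← hα, Category.assoc]
  constructor
  · intro H J
    apply ObjectProperty.hom_ext
    ext τ x
    obtain ⟨g, rfl⟩ : ∃ g : S.yT.obj (op τ) ⟶ J,
        R.typeEquiv (op τ) _ (adj'.homEquiv _ _ (l'.hom.app (op τ) ≫ g)) = x :=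
      ⟨l'.inv.app _ ≫ (adj'.homEquiv _ _).symm ((R.typeEquiv (op τ) _).symm x), by simp⟩
    exact (hr (op τ) J g).trans (by rw [H, h]; exact (h' _ _ _).symm)
  · intro H τ
    have hinj : Function.Injective ((r.hom.app (S.yT.obj τ)).hom.app τ.unop) :=
      (((ObjectProperty.ι _).mapIso (r.app (S.yT.obj τ))).app τ.unop).toEquiv.injective
    apply (adj.homEquiv _ _).injective
    apply (R.typeEquiv τ _).injective
    apply hinj
    -- The identity of `S.yT τ` is the universal element, so the condition on mates at this single
    -- instance already recovers the component of `α`.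
    have h₁ := hr τ _ (𝟙 _)
    rw [H, h', ← h τ _ (𝟙 _), Category.comp_id, Category.comp_id] at h₁
    exact h₁.symm

end TypeAdjunction

/-! ### Left and right adjoints exchanged by mates -/

section AdjointEquivalence

variable {T : Type u} [SmallCategory T] {R S : Schema T}

/-- Compatibility of an adjunction between a functor under the represented types and a functor
over type algebras with the strict identifications that these functors carry. -/
abbrev StrictlyCompatible {L : CosliceHom R.yT S.yT} {G : SliceHom S.U R.U}
    (adj : L.functor ⊣ G.functor) : Prop :=
  TypeCompatible adj (eqToIso L.comm) (eqToIso G.comm)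

/-- An arbitrary right adjoint commutes with the underlying type algebras only up to the induced
`r`; strictifying along `r` turns that isomorphism into the equality carried by `G`. -/
lemma exists_strictlyCompatible_right (L : LAdj R S) :
    ∃ (G : RAdj R S) (adj : L.obj.functor ⊣ G.obj.functor), StrictlyCompatible adj := by
  have := L.property
  let adj₀ := Adjunction.ofIsLeftAdjoint L.obj.functor
  obtain ⟨r, hr⟩ := exists_typeCompatible_right adj₀ (eqToIso L.obj.comm)
  obtain ⟨G, φ, hG, h⟩ := S.exists_strict_U R _ r
  let adj := adj₀.ofNatIsoRight φ.symm
  refine ⟨⟨⟨G, hG⟩, adj.isRightAdjoint⟩, adj, hr.ofNatIsoRight φ (eqToIso hG) fun J ↦ ?_⟩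
  rw [h, Category.assoc, Iso.inv_hom_id_app, Category.comp_id, eqToIso.hom, eqToHom_app]

lemma exists_strictlyCompatible_left (G : RAdj R S) :
    ∃ (L : LAdj R S) (adj : L.obj.functor ⊣ G.obj.functor), StrictlyCompatible adj := by
  have := G.property
  let adj₀ := Adjunction.ofIsRightAdjoint G.obj.functor
  obtain ⟨l, hl⟩ := exists_typeCompatible_left adj₀ (eqToIso G.obj.comm)
  obtain ⟨L, φ, hL, h⟩ := S.exists_strict_yT R _ l
  let adj := adj₀.ofNatIsoLeft φ.symm
  refine ⟨⟨⟨L, hL⟩, adj.isLeftAdjoint⟩, adj, hl.ofNatIsoLeft φ (eqToIso hL) fun τ ↦ ?_⟩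
  rw [h, Category.assoc, Iso.inv_hom_id_app, Category.comp_id, eqToIso.hom, eqToHom_app]

lemma StrictlyCompatible.conjugateEquiv_iff {L L' : CosliceHom R.yT S.yT} {G G' : SliceHom S.U R.U}
    {adj : L.functor ⊣ G.functor} {adj' : L'.functor ⊣ G'.functor} (h : StrictlyCompatible adj)
    (h' : StrictlyCompatible adj') (α : L.functor ⟶ L'.functor) :
    (∀ τ, α.app (R.yT.obj τ) = eqToHom (Functor.congr_obj (L.comm.trans L'.comm.symm) τ)) ↔
      ∀ J, R.U.map ((conjugateEquiv adj' adj α).app J) =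
        eqToHom (Functor.congr_obj (G'.comm.trans G.comm.symm) J) := by
  refine Iff.trans (forall_congr' fun τ ↦ ?_)
    ((TypeCompatible.conjugateEquiv_iff h h' α).trans (forall_congr' fun J ↦ ?_))
  · rw [eqToIso.hom, eqToIso.hom, eqToHom_app, eqToHom_app, comp_eqToHom_iff, eqToHom_trans]
  · rw [eqToIso.hom, eqToIso.hom, eqToHom_app, eqToHom_app, comp_eqToHom_iff, eqToHom_trans]

/-- The mate of a 2-cell under the represented types, as a 2-cell over type algebras. -/
def mate {L L' : LAdj R S} {G G' : RAdj R S} {adj : L.obj.functor ⊣ G.obj.functor}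
    {adj' : L'.obj.functor ⊣ G'.obj.functor} (h : StrictlyCompatible adj)
    (h' : StrictlyCompatible adj') (α : L ⟶ L') : G' ⟶ G :=
  ObjectProperty.homMk (SliceHom.homMk (conjugateEquiv adj' adj α.hom.nat)
    ((h.conjugateEquiv_iff h' _).1 (CosliceHom.nat_app _ _ α.hom)))

lemma rAdj_hom_ext {G G' : RAdj R S} {α β : G ⟶ G'} (h : α.hom.nat = β.hom.nat) : α = β :=
  ObjectProperty.hom_ext _ (SliceHom.hom_ext h)

lemma lAdj_hom_ext {L L' : LAdj R S} {α β : L ⟶ L'} (h : α.hom.nat = β.hom.nat) : α = β :=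
  ObjectProperty.hom_ext _ (CosliceHom.hom_ext h)

variable (R S) in
theorem exists_lAdj_equivalence_rAdj :
    ∃ (e : LAdj R S ≌ (RAdj R S)ᵒᵖ)
      (adj : ∀ L : LAdj R S, L.obj.functor ⊣ (e.functor.obj L).unop.obj.functor),
      ∀ {L L' : LAdj R S} (α : L ⟶ L'),
        (e.functor.map α).unop.hom.nat = conjugateEquiv (adj L') (adj L) α.hom.nat := by
  choose G adj h using exists_strictlyCompatible_right (R := R) (S := S)
  let Ψ : LAdj R S ⥤ (RAdj R S)ᵒᵖ :=
    { obj L := op (G L)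
      map {L L'} α := (mate (h L) (h L') α).op
      map_id L := Quiver.Hom.unop_inj (rAdj_hom_ext (conjugateEquiv_id _))
      map_comp {L L' L''} α β := Quiver.Hom.unop_inj (rAdj_hom_ext
        (conjugateEquiv_comp (adj L'') (adj L') (adj L) β.hom.nat α.hom.nat).symm) }
  have : Ψ.Faithful :=
    { map_injective {L L' α β} e := lAdj_hom_ext ((conjugateEquiv (adj L') (adj L)).injective
        (congrArg (fun t ↦ t.unop.hom.nat) e)) }
  have : Ψ.Full :=
    { map_surjective {L L'} β := by
        refine ⟨ObjectProperty.homMk (CosliceHom.homMk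
          ((conjugateEquiv (adj L') (adj L)).symm β.unop.hom.nat)
          (((h L).conjugateEquiv_iff (h L') _).2 fun J ↦ ?_)),
          Quiver.Hom.unop_inj (rAdj_hom_ext (Equiv.apply_symm_apply _ _))⟩
        rw [Equiv.apply_symm_apply]
        exact SliceHom.map_nat_app _ _ β.unop.hom J }
  have : Ψ.EssSurj :=
    -- A compatible left adjoint `L` of the given functor has the chosen `G L` as another right
    -- adjoint. The mates of the identity of `L` are inverse comparisons, and they lie over
    -- identities because both adjunctions are strictly compatible.
    { mem_essImage X := by
        obtain ⟨L, adj', h'⟩ := exists_strictlyCompatible_left X.unop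
        let i : X.unop ≅ G L :=
          { hom := mate (h L) h' (𝟙 L)
            inv := mate h' (h L) (𝟙 L)
            hom_inv_id := rAdj_hom_ext (conjugateEquiv_comm _ _ (Category.id_comp _))
            inv_hom_id := rAdj_hom_ext (conjugateEquiv_comm _ _ (Category.id_comp _)) }
        exact ⟨L, ⟨i.op⟩⟩ }
  have : Ψ.IsEquivalence := { }
  exact ⟨Ψ.asEquivalence, adj, fun _ ↦ rfl⟩

end AdjointEquivalence

/-! ### Density, nerves and left Kan extension along Yoneda -/

section KanExtension

variable {T : Type u} [SmallCategory T] {R S : Schema T}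

lemma Schema.yEquiv_symm_map {I : R.Inst} {r r' : R.Col} (f : r ⟶ r') (x : I.obj.obj r) :
    (R.yEquiv (op r') I).symm (I.obj.map f x) = R.y.map f.op ≫ (R.yEquiv (op r) I).symm x :=
  (R.yEquiv (op r') I).injective (by
    rw [R.yEquiv_map_comp, Equiv.apply_symm_apply, Equiv.apply_symm_apply]
    rfl)

/-- A map out of an instance, from its composites with the maps out of representables. -/
def Schema.descY {I J : R.Inst} (φ : ∀ r, I.obj.obj r → (R.y.obj (op r) ⟶ J))
    (hφ : ∀ {r r'} (f : r ⟶ r') (x : I.obj.obj r), φ r' (I.obj.map f x) = R.y.map f.op ≫ φ r x) :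
    I ⟶ J :=
  ObjectProperty.homMk
    { app r := ↾fun x ↦ R.yEquiv (op r) J (φ r x)
      naturality r r' f := by
        ext x
        exact (congrArg (R.yEquiv (op r') J) (hφ f x)).trans (R.yEquiv_map_comp f.op _) }

lemma Schema.comp_descY {I J : R.Inst} (φ : ∀ r, I.obj.obj r → (R.y.obj (op r) ⟶ J))
    (hφ : ∀ {r r'} (f : r ⟶ r') (x : I.obj.obj r), φ r' (I.obj.map f x) = R.y.map f.op ≫ φ r x)
    {r : R.Colᵒᵖ} (g : R.y.obj r ⟶ I) : g ≫ R.descY φ hφ = φ r.unop (R.yEquiv r I g) :=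
  (R.yEquiv r J).injective (R.yEquiv_comp g _)

lemma Schema.hom_ext_y {I J : R.Inst} {m m' : I ⟶ J}
    (h : ∀ (r : R.Colᵒᵖ) (g : R.y.obj r ⟶ I), g ≫ m = g ≫ m') : m = m' := by
  apply ObjectProperty.hom_ext
  ext r x
  obtain ⟨g, rfl⟩ := (R.yEquiv (op r) I).surjective x
  exact congrArg (R.yEquiv (op r) J) (h _ g)

variable (R) in
/-- The Yoneda embedding into instances is dense. -/
def Schema.denseAtY (I : R.Inst) : R.y.DenseAt I where
  desc s := R.descY (fun r x ↦ s.ι.app (CostructuredArrow.mk ((R.yEquiv (op r) I).symm x)))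
    fun {r r'} f x ↦ by
      let φ : CostructuredArrow.mk ((R.yEquiv (op r') I).symm (I.obj.map f x)) ⟶
          CostructuredArrow.mk ((R.yEquiv (op r) I).symm x) :=
        CostructuredArrow.homMk f.op (R.yEquiv_symm_map f x).symm
      exact (s.w φ).symm
  fac s j := by
    have h : ((Functor.LeftExtension.mk (𝟭 R.Inst) R.y.rightUnitor.inv).coconeAt I).ι.app j =
        j.hom := Category.id_comp _
    rw [h]
    refine (R.comp_descY _ _ j.hom).trans ?_
    rw [Equiv.symm_apply_apply]
    rfl
  uniq s (m : I ⟶ s.pt) hm := R.hom_ext_y fun r (g : R.y.obj r ⟶ I) ↦ by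
    refine Eq.trans ?_ (R.comp_descY (I := I) _ _ g).symm
    rw [Equiv.symm_apply_apply]
    refine Eq.trans ?_ (hm (CostructuredArrow.mk g))
    exact congrArg (· ≫ m) (Category.id_comp g).symm

/-- A left adjoint functor on instances is a pointwise left Kan extension of its restriction along
the Yoneda embedding. -/
def isPointwiseLeftKanExtensionOfIsLeftAdjoint {M : R.Colᵒᵖ ⥤ S.Inst} (L : R.Inst ⥤ S.Inst)
    [L.IsLeftAdjoint] (κ : M ⟶ R.y ⋙ L) (hκ : IsIso κ) :
    (Functor.LeftExtension.mk (L := R.y) (F := M) L κ).IsPointwiseLeftKanExtension := fun I ↦ by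
  -- A left adjoint preserves the canonical colimit of representables; the rest rewrites the diagram
  -- along `κ`.
  have h := isColimitOfPreserves L (R.denseAtY I)
  refine IsColimit.ofIsoColimit ((IsColimit.precomposeHomEquiv
    (Functor.isoWhiskerLeft (CostructuredArrow.proj R.y I) (asIso κ)) _).symm h)
    (Cocone.ext (Iso.refl _) fun j ↦ ?_)
  change (κ.app j.left ≫ L.map (𝟙 _ ≫ j.hom)) ≫ 𝟙 _ = κ.app j.left ≫ L.map j.hom
  rw [Category.id_comp, Category.comp_id]

/-- The nerve of a functor into instances that represents types on types. -/
def Schema.nerve (M : TypeFunctors R S) : S.Inst ⥤ R.Inst where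
  obj J := ⟨M.functor.rightOp ⋙ yoneda.obj J, by
    -- On types `M` takes represented values, so by Yoneda the nerve of `J` restricts to the type
    -- algebra of `J`, and product preservation is inherited.
    let e : R.iT ⋙ M.functor.rightOp ⋙ yoneda.obj J ≅ S.iT ⋙ J.obj :=
      NatIso.ofComponents (fun τ ↦
        ((eqToIso M.comm).app (op τ)).homFromEquiv.toIso ≪≫ (S.typeEquiv (op τ) J).toIso)
        fun {τ τ'} f ↦ by
          ext g
          have h := (eqToIso M.comm).inv.naturality_assoc f.op g
          exact (congrArg (S.typeEquiv (op τ') J) h.symm).trans (S.typeEquiv_map_comp f.op _)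
    have := J.property
    exact ⟨fun n ↦ have := this.preserves n; preservesLimitsOfShape_of_natIso e.symm⟩⟩
  map g := ObjectProperty.homMk (Functor.whiskerLeft _ (yoneda.map g))

/-- Morphisms from a value of `M`, as morphisms from a representable to the nerve. -/
def nerveEquiv (M : TypeFunctors R S) (r : R.Colᵒᵖ) (J : S.Inst) :
    (M.functor.obj r ⟶ J) ≃ (R.y.obj r ⟶ (Schema.nerve M).obj J) :=
  (R.yEquiv r ((Schema.nerve M).obj J)).symm

lemma nerveEquiv_comp (M : TypeFunctors R S) {r : R.Colᵒᵖ} {J J' : S.Inst}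
    (x : M.functor.obj r ⟶ J) (g : J ⟶ J') :
    nerveEquiv M r J' (x ≫ g) = nerveEquiv M r J x ≫ (Schema.nerve M).map g := by
  apply (nerveEquiv M r J').symm.injective
  rw [Equiv.symm_apply_apply]
  exact congrArg (· ≫ g) ((nerveEquiv M r J).symm_apply_apply x).symm

lemma nerveEquiv_map_comp (M : TypeFunctors R S) {r r' : R.Colᵒᵖ} {J : S.Inst} (f : r ⟶ r')
    (x : M.functor.obj r' ⟶ J) :
    nerveEquiv M r J (M.functor.map f ≫ x) = R.y.map f ≫ nerveEquiv M r' J x :=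
  R.yEquiv_symm_map (I := (Schema.nerve M).obj J) f.unop x

/-- The value of the left adjoint at the representable of `r` is `M(r)`. Objects at which a left
adjoint is defined are closed under colimits that exist downstairs, and representables are dense, so
cocompleteness of `S.Inst` finishes. -/
lemma Schema.isRightAdjoint_nerve [HasFiniteProducts T] (M : TypeFunctors R S) :
    (Schema.nerve M).IsRightAdjoint := by
  rw [Functor.isRightAdjoint_iff_leftAdjointObjIsDefined_eq_top]
  ext I
  simp only [Pi.top_apply, Prop.top_eq_true, iff_true]
  have : (Schema.nerve M).leftAdjointObjIsDefined I :=
    Functor.leftAdjointObjIsDefined_of_isColimit (R.denseAtY I) fun j ↦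
      Functor.CorepresentableBy.isCorepresentable (X := M.functor.obj j.left)
        { homEquiv {J} := nerveEquiv M j.left J
          homEquiv_comp g f := nerveEquiv_comp M f g }
  exact this

theorem exists_extension_y [HasFiniteProducts T] (M : TypeFunctors R S) :
    ∃ L : LAdj R S, Nonempty ((restrictY R S).obj L ≅ M) := by
  have := Schema.isRightAdjoint_nerve M
  let adj₀ := Adjunction.ofIsRightAdjoint (Schema.nerve M)
  obtain ⟨κ, -⟩ := exists_iso_of_homEquiv adj₀ R.y M.functor
    (nerveEquiv M) (nerveEquiv_comp M) (nerveEquiv_map_comp M)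
  -- Strictifying along the restriction of `κ` to types makes `φ` there the inverse of `κ` up to
  -- `eqToHom`, so the composite of `φ` and `κ` is an identity on types.
  obtain ⟨L, φ, hL, h⟩ := S.exists_strict_yT R _
    (Functor.isoWhiskerLeft R.iT.op κ ≪≫ eqToIso M.comm : R.yT ⋙ _ ≅ _)
  refine ⟨⟨⟨L, hL⟩, (adj₀.ofNatIsoLeft φ.symm).isLeftAdjoint⟩, ⟨CosliceHom.isoMk
    (Functor.isoWhiskerLeft R.y φ ≪≫ κ) fun τ ↦ ?_⟩⟩
  change φ.hom.app (R.yT.obj τ) ≫ κ.hom.app (R.iT.op.obj τ) = _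
  rw [h]
  have : (Functor.isoWhiskerLeft R.iT.op κ ≪≫ eqToIso M.comm).inv.app τ =
      eqToHom (Functor.congr_obj M.comm τ).symm ≫ κ.inv.app (R.iT.op.obj τ) := by
    simp [eqToHom_app]
  rw [Category.assoc]
  erw [this]
  simp
  rfl

lemma isLeftKanExtension_of_isLeftAdjoint (L : R.Inst ⥤ S.Inst) [L.IsLeftAdjoint] :
    L.IsLeftKanExtension (𝟙 (R.y ⋙ L)) :=
  (isPointwiseLeftKanExtensionOfIsLeftAdjoint L (𝟙 _) inferInstance).isLeftKanExtension

instance : (restrictY R S).Faithful where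
  map_injective {L L' α β} h := lAdj_hom_ext (by
    have := L.property
    have := isLeftKanExtension_of_isLeftAdjoint L.obj.functor
    refine L.obj.functor.hom_ext_of_isLeftKanExtension (𝟙 (R.y ⋙ L.obj.functor)) _ _ ?_
    rw [Category.id_comp, Category.id_comp]
    exact congrArg CosliceHom.Hom.nat h)

instance : (restrictY R S).Full where
  map_surjective {L L'} β := by
    have := L.property
    have := isLeftKanExtension_of_isLeftAdjoint L.obj.functor
    -- The extension `γ` is automatically a 2-cell under types, because that condition only involves
    -- its components at representables, where it is `β`.
    let γ := L.obj.functor.descOfIsLeftKanExtension (𝟙 (R.y ⋙ L.obj.functor)) L'.obj.functor β.nat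
    have hγ : R.y.whiskerLeft γ = β.nat := by
      rw [← Category.id_comp (R.y.whiskerLeft γ)]
      exact L.obj.functor.descOfIsLeftKanExtension_fac (𝟙 _) _ _
    exact ⟨ObjectProperty.homMk (CosliceHom.homMk γ fun τ ↦
      (NatTrans.congr_app hγ (R.iT.op.obj τ)).trans (CosliceHom.nat_app _ _ β τ)),
      CosliceHom.hom_ext hγ⟩

variable (R S) in
theorem exists_typeFunctors_equivalence_lAdj [HasFiniteProducts T] :
    ∃ (e : TypeFunctors R S ≌ LAdj R S) (κ : e.inverse ≅ restrictY R S),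
      ∀ M : TypeFunctors R S,
        Nonempty (Functor.LeftExtension.mk (L := R.y) (F := M.functor)
          (e.functor.obj M).obj.functor
          (e.unit.app M ≫ κ.hom.app (e.functor.obj M)).nat).IsPointwiseLeftKanExtension := by
  have : (restrictY R S).EssSurj := ⟨fun M ↦ exists_extension_y M⟩
  have : (restrictY R S).IsEquivalence := { }
  refine ⟨(restrictY R S).asEquivalence.symm, Iso.refl _, fun M ↦ ?_⟩
  have := ((restrictY R S).asEquivalence.symm.functor.obj M).property
  have : IsIso ((restrictY R S).asEquivalence.symm.unit.app M ≫
    (Iso.refl (restrictY R S)).hom.app ((restrictY R S).asEquivalence.symm.functor.obj M)).nat :=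
    ((CosliceHom.forget R.iT.op S.yT).mapIso
      ((restrictY R S).asEquivalence.symm.unitIso.app M ≪≫
        (Iso.refl (restrictY R S)).app _)).isIso_hom
  exact ⟨isPointwiseLeftKanExtensionOfIsLeftAdjoint _ _ this⟩

end KanExtension

/-! ### Co-Yoneda: composition with companions and conjoints -/

section CoYoneda

namespace Prof

variable {C D E : Type u} [SmallCategory C] [SmallCategory D] [SmallCategory E]

lemma coend_boxProd_condition (A : D ⥤ Type u) (B : Dᵒᵖ ⥤ Type u) {d d' : D} (f : d ⟶ d')
    (a : A.obj d) (b : B.obj (op d')) :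
    coend.ι (boxProd A B) d (a, B.map f.op b) = coend.ι (boxProd A B) d' (A.map f a, b) :=
  ConcreteCategory.congr_hom (C := Type u) (coend.condition (boxProd A B) f)
    (Prod.mk (α := A.obj d) (β := B.obj (op d')) a b)

lemma coend_map_ι {A A' : D ⥤ Type u} {B B' : Dᵒᵖ ⥤ Type u} (α : A ⟶ A') (β : B ⟶ B') (d : D)
    (x : A.obj d × B.obj (op d)) :
    coend.map (boxMap α β) (coend.ι (boxProd A B) d x) =
      coend.ι (boxProd A' B') d (α.app d x.1, β.app (op d) x.2) :=
  ConcreteCategory.congr_hom (coend.ι_map (boxMap α β) d) x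

/-- The co-Yoneda lemma, for a covariant representable. -/
def coendCoyonedaIso (x : Dᵒᵖ) (B : Dᵒᵖ ⥤ Type u) :
    coend (boxProd (coyoneda.obj x) B) ≅ B.obj x where
  hom := coend.desc (fun d ↦ ↾fun p ↦ B.map (Quiver.Hom.op p.1) p.2) fun d d' f ↦ by
    ext p
    exact (ConcreteCategory.congr_hom (B.map_comp f.op (Quiver.Hom.op p.1)) p.2).symm
  inv := ↾fun b ↦ coend.ι (boxProd (coyoneda.obj x) B) x.unop (𝟙 _, b)
  hom_inv_id := by
    apply coend.hom_ext
    intro d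
    rw [coend.ι_desc_assoc]
    ext p
    exact (coend_boxProd_condition (coyoneda.obj x) B p.1 (𝟙 _) p.2).trans
      (congrArg (fun t ↦ coend.ι (boxProd (coyoneda.obj x) B) d (t, p.2)) (Category.id_comp p.1))
  inv_hom_id := by
    ext b
    refine (ConcreteCategory.congr_hom (coend.ι_desc (F := boxProd (coyoneda.obj x) B) _ _ x.unop)
      (Prod.mk (α := x.unop ⟶ x.unop) (β := B.obj x) (𝟙 x.unop) b)).trans ?_
    exact ConcreteCategory.congr_hom (B.map_id x) b

/-- The inverse has the explicit form `b ↦ [𝟙, b]`, so naturality reduces to sliding `f` across one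
coend relation. -/
lemma coendCoyonedaIso_inv_map {x x' : Dᵒᵖ} {B B' : Dᵒᵖ ⥤ Type u} (f : x ⟶ x') (β : B ⟶ B') :
    (coendCoyonedaIso x B).inv ≫ coend.map (boxMap (coyoneda.map f) β) =
      (B.map f ≫ β.app x') ≫ (coendCoyonedaIso x' B').inv := by
  ext b
  refine (coend_map_ι (coyoneda.map f) β _ _).trans ?_
  have h := coend_boxProd_condition (coyoneda.obj x') B' f.unop (𝟙 _) (β.app x b)
  have h' := ConcreteCategory.congr_hom (β.naturality f) b
  exact (congrArg (fun t ↦ coend.ι (boxProd (coyoneda.obj x') B') x.unop (t, β.app x b))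
    ((Category.comp_id f.unop).trans (Category.id_comp f.unop).symm)).trans (h.symm.trans
      (congrArg (fun t ↦ coend.ι (boxProd (coyoneda.obj x') B') x'.unop (𝟙 _, t)) h'.symm))

/-- The co-Yoneda lemma, for a contravariant representable. -/
def coendYonedaIso (A : D ⥤ Type u) (x : D) :
    coend (boxProd A (yoneda.obj x)) ≅ A.obj x where
  hom := coend.desc (fun d ↦ ↾fun p ↦ A.map p.2 p.1) fun d d' f ↦ by
    ext p
    exact (ConcreteCategory.congr_hom (A.map_comp f p.2) p.1)
  inv := ↾fun a ↦ coend.ι (boxProd A (yoneda.obj x)) x (a, 𝟙 _)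
  hom_inv_id := by
    apply coend.hom_ext
    intro d
    rw [coend.ι_desc_assoc]
    ext p
    exact (coend_boxProd_condition A (yoneda.obj x) p.2 p.1 (𝟙 _)).symm.trans
      (congrArg (fun t ↦ coend.ι (boxProd A (yoneda.obj x)) d (p.1, t)) (Category.comp_id p.2))
  inv_hom_id := by
    ext a
    refine (ConcreteCategory.congr_hom (coend.ι_desc (F := boxProd A (yoneda.obj x)) _ _ x)
      (Prod.mk (α := A.obj x) (β := x ⟶ x) a (𝟙 x))).trans ?_
    exact ConcreteCategory.congr_hom (A.map_id x) a

lemma coendYonedaIso_inv_map (A : D ⥤ Type u) {x x' : D} (f : x ⟶ x') :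
    (coendYonedaIso A x).inv ≫ coend.map (boxMap (𝟙 A) (yoneda.map f)) =
      A.map f ≫ (coendYonedaIso A x').inv := by
  ext a
  refine (coend_map_ι (𝟙 A) (yoneda.map f) _ _).trans ?_
  have h := coend_boxProd_condition A (yoneda.obj x') f a (𝟙 _)
  exact (congrArg (fun t ↦ coend.ι (boxProd A (yoneda.obj x')) x (a, t))
    ((Category.id_comp f).trans (Category.comp_id f).symm)).trans h

/-- Composing with a companion on the left is restriction. -/
def companionCompIso (F : C ⥤ D) (N : Prof D E) : (companion F).comp N ≅ F.op ⋙ N :=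
  (NatIso.ofComponents (fun c ↦ NatIso.ofComponents
    (fun e ↦ (coendCoyonedaIso (F.op.obj c) (N.flip.obj e)).symm) (fun {e e'} f ↦ by
      have h := coendCoyonedaIso_inv_map (𝟙 (F.op.obj c)) (N.flip.map f)
      rw [(coyoneda).map_id, (N.flip.obj e).map_id, Category.id_comp] at h
      exact h.symm)) fun {c c'} f ↦ by
      ext e : 2
      have h := coendCoyonedaIso_inv_map (F.op.map f) (𝟙 (N.flip.obj e))
      rw [NatTrans.id_app, Category.comp_id] at h
      exact h.symm).symm

lemma companionCompIso_inv_whiskerLeft (F : C ⥤ D) {N N' : Prof D E} (φ : N ⟶ N') :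
    (companionCompIso F N).inv ≫ (companion F).whiskerLeft φ =
      F.op.whiskerLeft φ ≫ (companionCompIso F N').inv := by
  ext c e : 4
  have h := coendCoyonedaIso_inv_map (𝟙 (F.op.obj c)) (((flipFunctor _ _ _).map φ).app e)
  rw [(coyoneda).map_id, CategoryTheory.Functor.map_id, Category.id_comp] at h
  exact h

/-- Composing with a conjoint on the right is restriction. -/
def compConjointIso (M : Prof E D) (F : C ⥤ D) (x : Eᵒᵖ) :
    (M.comp (conjoint F)).obj x ≅ F ⋙ M.obj x :=
  (NatIso.ofComponents (fun c ↦ (coendYonedaIso (M.obj x) (F.obj c)).symm) fun f ↦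
    (coendYonedaIso_inv_map (M.obj x) (F.map f)).symm).symm

end Prof

end CoYoneda

/-! ### Bimodules as profunctors -/

section ProfunctorEquivalence

variable {T : Type u} [SmallCategory T] {R S : Schema T}

lemma isAlgebraic_comp_conjoint_iff (M : Prof R.Col S.Col) :
    (M.comp (Prof.conjoint S.iT)).IsAlgebraic ↔ ∀ r, S.isInst (M.obj r) := by
  have h {F G : T ⥤ Type u} (e : F ≅ G) (_ : PreservesFiniteProducts F) :
      PreservesFiniteProducts G :=
    ⟨fun n ↦ preservesLimitsOfShape_of_natIso e⟩
  exact forall_congr' fun r ↦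
    ⟨h (Prof.compConjointIso M S.iT r), h (Prof.compConjointIso M S.iT r).symm⟩

namespace ProfBimod

/-- The identification on types, in terms of the restriction to types. -/
def restrictIso (M : ProfBimod R S) : R.iT.op ⋙ M.prof ≅ Prof.companion S.iT :=
  (Prof.companionCompIso R.iT M.prof).symm ≪≫ M.unitIso

/-- Naturality of the co-Yoneda isomorphism in the profunctor removes the coends from the condition
on morphisms. -/
lemma whisker_eq_iff (M N : ProfBimod R S) (φ : M.prof ⟶ N.prof) :
    M.unitIso.inv ≫ (Prof.companion R.iT).whiskerLeft φ ≫ N.unitIso.hom = 𝟙 _ ↔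
      R.iT.op.whiskerLeft φ ≫ N.restrictIso.hom = M.restrictIso.hom := by
  rw [Iso.inv_comp_eq, Category.comp_id]
  dsimp only [restrictIso, Iso.trans_hom, Iso.symm_hom]
  rw [← Category.assoc, ← Prof.companionCompIso_inv_whiskerLeft, Category.assoc,
    cancel_epi]

lemma hom_ext {M N : ProfBimod R S} {α β : M ⟶ N} (h : Hom.nat α = Hom.nat β) : α = β :=
  Hom.ext h

/-- Constructor for isomorphisms of `ProfBimod`. -/
def isoMk {M N : ProfBimod R S} (φ : M.prof ≅ N.prof)
    (h : R.iT.op.whiskerLeft φ.hom ≫ N.restrictIso.hom = M.restrictIso.hom) : M ≅ N where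
  hom := ⟨φ.hom, (whisker_eq_iff M N _).2 h⟩
  inv := ⟨φ.inv, (whisker_eq_iff N M _).2 (by
    rw [← h, ← Category.assoc, ← Functor.whiskerLeft_comp, Iso.inv_hom_id,
      Functor.whiskerLeft_id', Category.id_comp])⟩
  hom_inv_id := hom_ext φ.hom_inv_id
  inv_hom_id := hom_ext φ.inv_hom_id

end ProfBimod

namespace SchemaBimod

lemma hom_ext {M N : SchemaBimod R S} {α β : M ⟶ N} (h : Hom.nat α = Hom.nat β) : α = β :=
  Hom.ext h

/-- The underlying profunctor of a bimodule. -/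
def toProfBimodObj (M : SchemaBimod R S) : ProfBimod R S where
  prof := M.functor ⋙ S.isInst.ι
  algebraic := (isAlgebraic_comp_conjoint_iff _).2 fun r ↦ (M.functor.obj r).property
  unitIso := Prof.companionCompIso R.iT (M.functor ⋙ S.isInst.ι) ≪≫
    Functor.isoWhiskerRight (eqToIso M.comm) S.isInst.ι

lemma toProfBimodObj_restrictIso (M : SchemaBimod R S) :
    M.toProfBimodObj.restrictIso = Functor.isoWhiskerRight (eqToIso M.comm) S.isInst.ι :=
  Iso.symm_self_id_assoc _ _

lemma whiskerLeft_restrictIso_iff (M N : SchemaBimod R S) (α : M.functor ⟶ N.functor) :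
    R.iT.op.whiskerLeft (Functor.whiskerRight α S.isInst.ι) ≫ N.toProfBimodObj.restrictIso.hom =
      M.toProfBimodObj.restrictIso.hom ↔
    ∀ τ : T, α.app (op (R.iT.obj τ)) = eqToHom ((M.obj_eq τ).trans (N.obj_eq τ).symm) := by
  rw [toProfBimodObj_restrictIso, toProfBimodObj_restrictIso]
  have key (τ : T) : α.app (op (R.iT.obj τ)) = eqToHom ((M.obj_eq τ).trans (N.obj_eq τ).symm) ↔
      α.app (op (R.iT.obj τ)) ≫ (eqToIso N.comm).hom.app (op τ) =
        (eqToIso M.comm).hom.app (op τ) := by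
    rw [eqToIso.hom, eqToIso.hom, eqToHom_app, eqToHom_app, comp_eqToHom_iff, eqToHom_trans]
  refine Iff.trans ⟨fun h τ ↦ ?_, fun h ↦ ?_⟩ (forall_congr' key).symm
  · exact S.isInst.ι.map_injective (NatTrans.congr_app h (op τ))
  · ext τ : 2
    exact congrArg S.isInst.ι.map (h τ.unop)

variable (R S) in
/-- The functor sending a bimodule to its underlying profunctor. -/
def toProfBimod : SchemaBimod R S ⥤ ProfBimod R S where
  obj M := M.toProfBimodObj
  map {M N} α := ⟨Functor.whiskerRight α.nat S.isInst.ι, (ProfBimod.whisker_eq_iff _ _ _).2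
    ((whiskerLeft_restrictIso_iff M N _).2 α.app_type)⟩

instance : (toProfBimod R S).Faithful where
  map_injective h := hom_ext (((Functor.whiskeringRight _ _ _).obj
    S.isInst.ι).map_injective (congrArg ProfBimod.Hom.nat h))

instance : (toProfBimod R S).Full where
  map_surjective {M N} φ := by
    obtain ⟨α, hα⟩ : ∃ α : M.functor ⟶ N.functor,
        Functor.whiskerRight α S.isInst.ι = φ.nat :=
      ((Functor.whiskeringRight _ _ _).obj S.isInst.ι).map_surjective φ.nat
    refine ⟨⟨α, (whiskerLeft_restrictIso_iff M N α).1 ?_⟩, ProfBimod.hom_ext hα⟩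
    rw [hα]
    exact (ProfBimod.whisker_eq_iff _ _ _).1 φ.whisker_eq

instance : (toProfBimod R S).EssSurj where
  mem_essImage P := by
    -- Algebraicity says exactly that the profunctor takes values in instances. Its identification
    -- on types lifts along the fully faithful inclusion and is then made strict, using that `R.iT`
    -- is injective on objects.
    let M₀ : R.Colᵒᵖ ⥤ S.Inst := S.isInst.lift P.prof
      ((isAlgebraic_comp_conjoint_iff _).1 P.algebraic)
    let θ : R.iT.op ⋙ M₀ ≅ S.yT :=
      ((Functor.whiskeringRight _ _ _).obj S.isInst.ι).preimageIso P.restrictIso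
    have hθ : ((Functor.whiskeringRight _ _ _).obj S.isInst.ι).map θ.hom = P.restrictIso.hom :=
      Functor.map_preimage _ _
    obtain ⟨M, φ, hM, h⟩ := exists_strict_extension R.iT.op S.yT (fun a b e ↦ by
      obtain rfl : a = b := congrArg op (iT_obj_injective R (congrArg unop e))
      exact ⟨𝟙 a, rfl, by simp, by simp⟩) M₀ θ
    refine ⟨⟨M, hM⟩, ⟨ProfBimod.isoMk (Functor.isoWhiskerRight φ S.isInst.ι) ?_⟩⟩
    dsimp only [toProfBimod]
    rw [toProfBimodObj_restrictIso, ← hθ]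
    ext τ : 2
    refine congrArg S.isInst.ι.map (?_ : φ.hom.app (R.iT.op.obj τ) ≫ θ.hom.app τ =
      (eqToIso hM).hom.app τ)
    rw [h, Category.assoc, Iso.inv_hom_id_app, Category.comp_id, eqToIso.hom, eqToHom_app]

instance : (toProfBimod R S).IsEquivalence where

variable (R S) in
/-- Bimodules, as functors under the opposite of the category of types. -/
def typeFunctorsEquivalence : SchemaBimod R S ≌ TypeFunctors R S where
  functor :=
    { obj M := ⟨M.functor, M.comm⟩
      map α := CosliceHom.homMk α.nat fun τ ↦ α.app_type τ.unop }
  inverse :=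
    { obj M := ⟨M.functor, M.comm⟩
      map α := ⟨α.nat, fun τ ↦ CosliceHom.nat_app _ _ α (op τ)⟩ }
  unitIso := Iso.refl _
  counitIso := Iso.refl _

end SchemaBimod

end ProfunctorEquivalence

end

end AlgDB

theorem mainTheorem1 {T : Type u} [SmallCategory T] [HasFiniteProducts T] (R S : Schema T) :
    (∃ e : SchemaBimod R S ≌ TypeFunctors R S, e.functor ⋙ CosliceHom.forget _ _ = SchemaBimod.forget R S) ∧
    (∃ e : SchemaBimod R S ≌ ProfBimod R S,
      Nonempty (e.functor ⋙ ProfBimod.forget R S ≅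
        SchemaBimod.forget R S ⋙ (Functor.whiskeringRight _ _ _).obj S.isInst.ι)) ∧
    (∃ (e : TypeFunctors R S ≌ LAdj R S) (κ : e.inverse ≅ restrictY R S),
      ∀ M : TypeFunctors R S,
        Nonempty (Functor.LeftExtension.mk (L := R.y) (F := M.functor) (e.functor.obj M).obj.functor
          (e.unit.app M ≫ κ.hom.app (e.functor.obj M)).nat).IsPointwiseLeftKanExtension) ∧
    (∃ (e : LAdj R S ≌ (RAdj R S)ᵒᵖ)
      (adj : ∀ L : LAdj R S, L.obj.functor ⊣ (e.functor.obj L).unop.obj.functor),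
      ∀ {L L' : LAdj R S} (α : L ⟶ L'),
        (e.functor.map α).unop.hom.nat = conjugateEquiv (adj L') (adj L) α.hom.nat) :=
  ⟨⟨SchemaBimod.typeFunctorsEquivalence R S, rfl⟩,
    ⟨(SchemaBimod.toProfBimod R S).asEquivalence, ⟨Iso.refl _⟩⟩,
    exists_typeFunctors_equivalence_lAdj R S, exists_lAdj_equivalence_rAdj R S⟩
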